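/- **Definitions.** A pointwise non-decreasing sequence $V=(v_N)_{N\in\mathbb N}$ of positive continuous functions on $\mathbb R$ is a *weight system* if $v_0\ge 1$ and $$\forall N\ \exists M\ge N:\ \sup_{x,t\in\mathbb R,\,|t|\le 1}\frac{v_N(x+t)}{v_M(x)}<\infty .$$ It *satisfies (M)* if $$\forall N,M\ \exists K\ge N,M:\ \sup_{x\in\mathbb R}\frac{v_N(x)v_M(x)}{v_K(x)}<\infty .$$ For a positive continuous function $v$ on $\mathbb R$ and $n\in\mathbb N=\{0,1,2,\dots\}$, let $\mathscr B^n_v$ be the normed space of all $f\in C^n(\mathbb R)$ (with values in $\mathbb K=\mathbb R$ or $\mathbb C$) such that $$\|f\|_{v,n}=\max_{p\le n}\sup_{x\in\mathbb R}\frac{|f^{(p)}(x)|}{v(x)}<\infty .$$ Put $$\mathscr B_v=\varprojlim_{n}\mathscr B^n_v,\qquad \mathscr K_V=\varprojlim_{N}\mathscr B^N_{1/v_N},\qquad \mathscr O_{C,V}=\varinjlim_{N}\mathscr B_{v_N},$$ $$\mathscr O^n_{M,V}=\varinjlim_{N}\mathscr B^n_{v_N},\qquad \mathscr O_{M,V}=\varprojlim_{n}\mathscr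 O^n_{M,V},$$ where all limits are taken with respect to inclusion maps, in the category of locally convex spaces. For $\varphi:\mathbb R\to\mathbb R$ write $C_\varphi(f)=f\circ\varphi$. The statement "$C_\varphi:X\to Y$ is continuous" includes that $C_\varphi(X)\subseteq Y$. **Theorem.** Let $V=(v_N)_{N\in\mathbb N}$ and $W=(w_M)_{M\in\mathbb N}$ be two weight systems and let $\varphi:\mathbb R\to\mathbb R$ be smooth. Below, $\mathbb Z_+=\{1,2,\dots\}$. **(I)** Suppose that $V$ satisfies (M). The following statements are equivalent: - (i) $C_\varphi(\mathscr K_V)\subseteq\mathscr K_W$. - (ii) $C_\varphi:\mathscr K_V\to\mathscr K_W$ is continuous. - (iii) $\varphi$ satisfies both - (a) $\forall M\ \exists N:\ \sup_{x\in\mathbb R} \dfrac{w_M(x)}{v_N(\varphi(x))}<\infty$, and - (b) $\forall p\in\mathbb Z_+\ \exists N:\ \sup_{x\in\mathbb R} \dfrac{|\varphi^{(p)}(x)|}{v_N(\varphi(x))}<\infty$. **(II)** Suppose that $W$ satisfies (M). The following statements are equivalent: - (i) $C_\varphi(\mathscr O_{C,V})\subseteq\mathscr O_{C,W}$. - (ii)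 $C_\varphi:\mathscr O_{C,V}\to\mathscr O_{C,W}$ is continuous. - (iii) $\forall N\ \exists M$ such that $C_\varphi:\mathscr B_{v_N}\to\mathscr B_{w_M}$ is continuous. - (iv) $\varphi$ satisfies both - (a) $\forall N\ \exists M:\ \sup_{x\in\mathbb R} \dfrac{v_N(\varphi(x))}{w_M(x)}<\infty$, and - (b) $\exists M\ \forall p,k\in\mathbb Z_+:\ \sup_{x\in\mathbb R} \dfrac{|\varphi^{(p)}(x)|}{w_M^{1/k}(x)}<\infty$. **(III)** Suppose that $W$ satisfies (M). The following statements are equivalent: - (i) $C_\varphi(\mathscr O_{M,V})\subseteq\mathscr O_{M,W}$. - (ii) $C_\varphi:\mathscr O_{M,V}\to\mathscr O_{M,W}$ is continuous. - (iii) $C_\varphi:\mathscr O^n_{M,V}\to\mathscr O^n_{M,W}$ is continuous for all $n\in\mathbb N$. - (iv) $\varphi$ satisfies both - (a) $\forall N\ \exists M:\ \sup_{x\in\mathbb R} \dfrac{v_N(\varphi(x))}{w_M(x)}<\infty$, and - (b) $\forall p\in\mathbb Z_+\ \exists M:\ \sup_{x\in\mathbb R} \dfrac{|\varphi^{(p)}(x)|}{w_M(x)}<\infty$.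 -/

import Mathlib

open scoped ContDiff

/-- A positive continuous function on `ℝ`. -/
structure Weight where
  /-- the underlying function -/
  toFun : ℝ → ℝ
  continuous_toFun : Continuous toFun
  pos : ∀ x, 0 < toFun x

instance : CoeFun Weight (fun _ => ℝ → ℝ) := ⟨Weight.toFun⟩

/-- The weight `1 / v`. -/
noncomputable def Weight.inv (v : Weight) : Weight where
  toFun x := 1 / v x
  continuous_toFun := continuous_const.div v.continuous_toFun fun x => (v.pos x).ne'
  pos x := one_div_pos.2 (v.pos x)

/-- A weight system: a pointwise non-decreasing sequence of positive continuous functions on `ℝ`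
with `v₀ ≥ 1` which is stable under translations by `|t| ≤ 1`, up to a change of index. -/
structure WeightSystem where
  /-- the sequence of weights -/
  v : ℕ → Weight
  mono : ∀ N M, N ≤ M → ∀ x, v N x ≤ v M x
  one_le : ∀ x, 1 ≤ v 0 x
  shift : ∀ N, ∃ M, N ≤ M ∧ BddAbove {r : ℝ | ∃ x t : ℝ, |t| ≤ 1 ∧ r = v N (x + t) / v M x}

/-- The weight system is closed under products, up to a constant. -/
def WeightSystem.IsMultiplicative (V : WeightSystem) : Prop :=
  ∀ N M, ∃ K, N ≤ K ∧ M ≤ K ∧ BddAbove (Set.range fun x : ℝ => V.v N x * V.v M x / V.v K x)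

section Spaces

variable (𝕜 : Type*) [RCLike 𝕜]

/-- A linear space of functions `ℝ → 𝕜` together with a topology on it. -/
structure FunctionSpace where
  /-- the functions belonging to the space -/
  carrier : Submodule 𝕜 (ℝ → 𝕜)
  /-- the topology of the space -/
  topology : TopologicalSpace carrier

variable {𝕜}

namespace FunctionSpace

/-- The projective limit of a decreasing sequence of function spaces (with respect to the
inclusion maps): the intersection, with the coarsest topology making all inclusions into the
steps continuous. -/
def projLim (E : ℕ → FunctionSpace 𝕜) : FunctionSpace 𝕜 where
  carrier := ⨅ n, (E n).carrier
  topology := ⨅ n, TopologicalSpace.induced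
    (Submodule.inclusion (iInf_le (fun n => (E n).carrier) n)) (E n).topology

/-- The locally convex inductive limit of an increasing sequence of function spaces (with respect
to the inclusion maps): the union (the supremum of a chain of subspaces), with the finest locally
convex vector space topology making all inclusions of the steps continuous. In the order on
topologies, finer means smaller. -/
def indLim (E : ℕ → FunctionSpace 𝕜) : FunctionSpace 𝕜 where
  carrier := ⨆ n, (E n).carrier
  topology := sInf {t : TopologicalSpace ↥(⨆ n, (E n).carrier) |
    @IsTopologicalAddGroup ↥(⨆ n, (E n).carrier) t _ ∧
    @ContinuousSMul 𝕜 ↥(⨆ n, (E n).carrier) _ _ t ∧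
    @LocallyConvexSpace ℝ ↥(⨆ n, (E n).carrier) _ _ _ _ t ∧
    ∀ n, @Continuous _ _ (E n).topology t
      (Submodule.inclusion (le_iSup (fun n => (E n).carrier) n))}

/-- `C_φ (E) ⊆ F`, where `C_φ f = f ∘ φ`. -/
def CompMapsTo (φ : ℝ → ℝ) (E F : FunctionSpace 𝕜) : Prop :=
  ∀ f ∈ E.carrier, f ∘ φ ∈ F.carrier

/-- `C_φ : E → F`, `f ↦ f ∘ φ`, is well-defined and continuous. -/
def CompContinuous (φ : ℝ → ℝ) (E F : FunctionSpace 𝕜) : Prop :=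
  ∃ h : CompMapsTo φ E F,
    @Continuous E.carrier F.carrier E.topology F.topology
      (fun f => ⟨(f : ℝ → 𝕜) ∘ φ, h f f.2⟩)

end FunctionSpace

variable (𝕜)

/-- The vector space underlying `𝓑ⁿ_v`: all `f ∈ Cⁿ(ℝ)` such that `|f⁽ᵖ⁾| / v` is bounded for all
`p ≤ n`. -/
noncomputable def weightedSubmodule (v : Weight) (n : ℕ) : Submodule 𝕜 (ℝ → 𝕜) where
  carrier := {f | ContDiff ℝ n f ∧
    ∀ p ≤ n, BddAbove (Set.range fun x : ℝ => ‖iteratedDeriv p f x‖ / v x)}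
  zero_mem' := by
    refine ⟨contDiff_const, fun p _ => ⟨0, ?_⟩⟩
    rintro _ ⟨x, rfl⟩
    have h : iteratedDeriv p (0 : ℝ → 𝕜) x = 0 := by
      simp
    simp [h]
  add_mem' := by
    rintro f g ⟨hf, hf'⟩ ⟨hg, hg'⟩
    refine ⟨hf.add hg, fun p hp => ?_⟩
    obtain ⟨A, hA⟩ := hf' p hp
    obtain ⟨B, hB⟩ := hg' p hp
    refine ⟨A + B, ?_⟩
    rintro _ ⟨x, rfl⟩
    have hpn : (p : WithTop ℕ∞) ≤ n := by exact_mod_cast hp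
    have e : iteratedDeriv p (f + g) x = iteratedDeriv p f x + iteratedDeriv p g x :=
      iteratedDeriv_add (hf.of_le hpn).contDiffAt (hg.of_le hpn).contDiffAt
    have h1 := hA ⟨x, rfl⟩
    have h2 := hB ⟨x, rfl⟩
    have h3 : ‖iteratedDeriv p (f + g) x‖ / v x
        ≤ (‖iteratedDeriv p f x‖ + ‖iteratedDeriv p g x‖) / v x := by
      rw [e]
      exact div_le_div_of_nonneg_right (norm_add_le _ _) (v.pos x).le
    rw [add_div] at h3
    exact h3.trans (add_le_add h1 h2)
  smul_mem' := by
    rintro c f ⟨hf, hf'⟩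
    refine ⟨hf.const_smul c, fun p hp => ?_⟩
    obtain ⟨A, hA⟩ := hf' p hp
    refine ⟨‖c‖ * A, ?_⟩
    rintro _ ⟨x, rfl⟩
    have e : iteratedDeriv p (c • f) x = c • iteratedDeriv p f x := by
      simp
    simp only [e, norm_smul, mul_div_assoc]
    exact mul_le_mul_of_nonneg_left (hA ⟨x, rfl⟩) (norm_nonneg c)

/-- The norm `‖f‖_{v,n} = max_{p ≤ n} sup_x |f⁽ᵖ⁾(x)| / v(x)` on `𝓑ⁿ_v`. -/
noncomputable def weightedNorm (v : Weight) (n : ℕ) : Seminorm 𝕜 (weightedSubmodule 𝕜 v n) :=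
  Seminorm.of
    (fun f => ⨆ p : Fin (n + 1), ⨆ x : ℝ, ‖iteratedDeriv p (f : ℝ → 𝕜) x‖ / v x)
    (by
      rintro ⟨f, hf, hf'⟩ ⟨g, hg, hg'⟩
      refine ciSup_le fun p => ciSup_le fun x => ?_
      have hp : (p : ℕ) ≤ n := Nat.lt_succ_iff.1 p.2
      have hpn : ((p : ℕ) : WithTop ℕ∞) ≤ n := by exact_mod_cast hp
      have e : iteratedDeriv p (f + g) x = iteratedDeriv p f x + iteratedDeriv p g x :=
        iteratedDeriv_add (hf.of_le hpn).contDiffAt (hg.of_le hpn).contDiffAt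
      have h3 : ‖iteratedDeriv p (f + g) x‖ / v x
          ≤ (‖iteratedDeriv p f x‖ + ‖iteratedDeriv p g x‖) / v x := by
        rw [e]
        exact div_le_div_of_nonneg_right (norm_add_le _ _) (v.pos x).le
      rw [add_div] at h3
      refine h3.trans (add_le_add ?_ ?_)
      · exact (le_ciSup (hf' p hp) x).trans
          (le_ciSup (f := fun p : Fin (n + 1) => ⨆ x : ℝ, ‖iteratedDeriv p f x‖ / v x)
            (Set.finite_range _).bddAbove p)
      · exact (le_ciSup (hg' p hp) x).trans
          (le_ciSup (f := fun p : Fin (n + 1) => ⨆ x : ℝ, ‖iteratedDeriv p g x‖ / v x)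
            (Set.finite_range _).bddAbove p))
    (by
      rintro c ⟨f, hf, hf'⟩
      have e : ∀ (p : ℕ) (x : ℝ), iteratedDeriv p (c • f) x = c • iteratedDeriv p f x := by
        intro p x
        simp
      change (⨆ p : Fin (n + 1), ⨆ x : ℝ, ‖iteratedDeriv p (c • f) x‖ / v x)
        = ‖c‖ * ⨆ p : Fin (n + 1), ⨆ x : ℝ, ‖iteratedDeriv p f x‖ / v x
      simp only [e, norm_smul, mul_div_assoc]
      rw [Real.mul_iSup_of_nonneg (norm_nonneg c)]
      simp_rw [Real.mul_iSup_of_nonneg (norm_nonneg c)])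

/-- The normed space `𝓑ⁿ_v`. -/
noncomputable def spaceBn (v : Weight) (n : ℕ) : FunctionSpace 𝕜 where
  carrier := weightedSubmodule 𝕜 v n
  topology := (weightedNorm 𝕜 v n).toAddGroupSeminorm.toSeminormedAddCommGroup
    |>.toPseudoMetricSpace.toUniformSpace.toTopologicalSpace

/-- `𝓑_v`, the projective limit over `n` of the spaces `𝓑ⁿ_v`. -/
noncomputable def spaceB (v : Weight) : FunctionSpace 𝕜 :=
  FunctionSpace.projLim fun n => spaceBn 𝕜 v n

/-- `𝓚_V`, the projective limit over `N` of the spaces `𝓑ᴺ_{1/v_N}`. -/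
noncomputable def spaceK (V : WeightSystem) : FunctionSpace 𝕜 :=
  FunctionSpace.projLim fun N => spaceBn 𝕜 (V.v N).inv N

/-- `𝓞_{C,V}`, the inductive limit over `N` of the projective limits over `n` of `𝓑ⁿ_{v_N}`. -/
noncomputable def spaceOC (V : WeightSystem) : FunctionSpace 𝕜 :=
  FunctionSpace.indLim fun N => spaceB 𝕜 (V.v N)

/-- `𝓞ⁿ_{M,V}`, the inductive limit over `N` of the spaces `𝓑ⁿ_{v_N}`. -/
noncomputable def spaceOMn (V : WeightSystem) (n : ℕ) : FunctionSpace 𝕜 :=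
  FunctionSpace.indLim fun N => spaceBn 𝕜 (V.v N) n

/-- `𝓞_{M,V}`, the projective limit over `n` of the inductive limits over `N` of `𝓑ⁿ_{v_N}`. -/
noncomputable def spaceOM (V : WeightSystem) : FunctionSpace 𝕜 :=
  FunctionSpace.projLim fun n => spaceOMn 𝕜 V n

end Spaces

/-! Continuity is never deduced from a closed graph theorem. The bare inclusion of the spaces
already forces the growth conditions on `φ`, and these give norm estimates, hence continuity between
the steps and then between the limits.

From conditions to continuity, the tool is the Faà di Bruno estimate
(`CompContinuous.of_weight_bound`): if `D ≥ 1` bounds the derivatives of `φ` of orders `1` to `n`,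
then those of `f ∘ φ` up to order `n` cost a factor `n! * D ^ n`. In (I) and (III), (M) absorbs this
power into one weight. In (II) the target weight must not depend on `n`; there `D` is a small root
of a fixed weight.

From inclusion to conditions, one tests on `localPow k (φ x)`, a bump at `φ x` times `(y - φ x) ^
k`. At `x`, its composition with `φ` has `k`-th derivative `k! * φ'(x) ^ k`; for `k = 1` its
derivatives of positive order are those of `φ`, and for `k = 0` its value is `1`. Absolutely
convergent series of suitably scaled test functions lie in the source space, so a Baire argument on
`ℓ¹` (`exists_uniform_comp_bound`) makes the bounds uniform over the family. For (I) the bumps are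
divided by the weights at their centres. For (a) in (II) and (III) one composes a smooth majorant of
`v_N` with `φ`. In (II) one weight then dominates all powers of `φ'` and all `φ^(p)`, and an
iterated Landau inequality (`exists_rpow_bound_of_landau`) extends the bound to all powers of all
derivatives. -/

section FunctionSpaces

variable {𝕜 : Type*} [RCLike 𝕜]

/-! ### Composition operators between projective and inductive limits -/

namespace FunctionSpace

theorem mem_projLim {E : ℕ → FunctionSpace 𝕜} {f : ℝ → 𝕜} :
    f ∈ (projLim E).carrier ↔ ∀ n, f ∈ (E n).carrier :=
  Submodule.mem_iInf _

theorem mem_indLim {E : ℕ → FunctionSpace 𝕜} (hE : Monotone fun n => (E n).carrier)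
    {f : ℝ → 𝕜} : f ∈ (indLim E).carrier ↔ ∃ n, f ∈ (E n).carrier :=
  Submodule.mem_iSup_of_directed _ hE.directed_le

/-- The linear map `f ↦ f ∘ φ` between function spaces. -/
def compLinearMap (φ : ℝ → ℝ) {E F : FunctionSpace 𝕜} (h : CompMapsTo φ E F) :
    E.carrier →ₗ[𝕜] F.carrier where
  toFun f := ⟨(f : ℝ → 𝕜) ∘ φ, h f f.2⟩
  map_add' _ _ := rfl
  map_smul' _ _ := rfl

theorem CompContinuous.projLim {φ : ℝ → ℝ} {E F : ℕ → FunctionSpace 𝕜}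
    (h : ∀ m, ∃ n, CompContinuous φ (E n) (F m)) :
    CompContinuous φ (projLim E) (projLim F) := by
  choose n hm hc using h
  refine ⟨fun f hf => mem_projLim.2 fun m => hm m f (mem_projLim.1 hf (n m)), ?_⟩
  refine continuous_iInf_rng.2 fun m => continuous_induced_rng.2 ?_
  refine @Continuous.comp _ _ _ (FunctionSpace.projLim E).topology (E (n m)).topology (F m).topology
    (Submodule.inclusion (iInf_le (fun n => (E n).carrier) (n m))) _ (hc m) ?_
  exact continuous_iInf_dom (i := n m) continuous_induced_dom

theorem indLim_isTopologicalAddGroup (E : ℕ → FunctionSpace 𝕜) :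
    @IsTopologicalAddGroup (indLim E).carrier (indLim E).topology _ :=
  topologicalAddGroup_sInf fun _ h => h.1

theorem indLim_continuousSMul (E : ℕ → FunctionSpace 𝕜) :
    @ContinuousSMul 𝕜 (indLim E).carrier _ _ (indLim E).topology :=
  continuousSMul_sInf fun _ h => h.2.1

theorem indLim_locallyConvexSpace (E : ℕ → FunctionSpace 𝕜) :
    @LocallyConvexSpace ℝ (indLim E).carrier _ _ _ _ (indLim E).topology :=
  LocallyConvexSpace.sInf fun _ h => h.2.2.1

theorem continuous_inclusion_indLim (E : ℕ → FunctionSpace 𝕜) (n : ℕ) :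
    @Continuous _ _ (E n).topology (indLim E).topology
      (Submodule.inclusion (le_iSup (fun n => (E n).carrier) n)) :=
  continuous_sInf_rng.2 fun _ h => h.2.2.2 n

theorem CompContinuous.indLim {φ : ℝ → ℝ} {E F : ℕ → FunctionSpace 𝕜}
    (hE : Monotone fun n => (E n).carrier) (hF : Monotone fun n => (F n).carrier)
    (h : ∀ n, ∃ m, CompContinuous φ (E n) (F m)) :
    CompContinuous φ (indLim E) (indLim F) := by
  choose m hm hc using h
  have hmaps : CompMapsTo φ (FunctionSpace.indLim E) (FunctionSpace.indLim F) := fun f hf => by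
    obtain ⟨n, hn⟩ := (mem_indLim hE).1 hf
    exact (mem_indLim hF).2 ⟨m n, hm n f hn⟩
  refine ⟨hmaps, ?_⟩
  let := (FunctionSpace.indLim F).topology
  have := indLim_isTopologicalAddGroup F
  have := indLim_continuousSMul F
  have := indLim_locallyConvexSpace F
  let T := compLinearMap φ hmaps
  -- The topology pulled back along `C_φ` is itself one of the locally convex topologies whose
  -- infimum defines the source, so the source topology is finer.
  refine continuous_iff_le_induced.2 (sInf_le ⟨topologicalAddGroup_induced T,
    continuousSMul_induced T, LocallyConvexSpace.induced (T.restrictScalars ℝ), fun n => ?_⟩)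
  refine continuous_induced_rng.2 ?_
  exact @Continuous.comp _ _ _ (E n).topology (F (m n)).topology _ _ _
    (continuous_inclusion_indLim F (m n)) (hc n)

theorem CompContinuous.of_bound {φ : ℝ → ℝ} {v w : Weight} {m n : ℕ} (C : ℝ)
    (hm : CompMapsTo φ (spaceBn 𝕜 v m) (spaceBn 𝕜 w n))
    (hC : ∀ f (hf : f ∈ weightedSubmodule 𝕜 v m),
      weightedNorm 𝕜 w n ⟨f ∘ φ, hm f hf⟩ ≤ C * weightedNorm 𝕜 v m ⟨f, hf⟩) :
    CompContinuous φ (spaceBn 𝕜 v m) (spaceBn 𝕜 w n) := by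
  refine ⟨hm, ?_⟩
  let : SeminormedAddCommGroup (spaceBn 𝕜 v m).carrier :=
    (weightedNorm 𝕜 v m).toAddGroupSeminorm.toSeminormedAddCommGroup
  let : SeminormedAddCommGroup (spaceBn 𝕜 w n).carrier :=
    (weightedNorm 𝕜 w n).toAddGroupSeminorm.toSeminormedAddCommGroup
  exact AddMonoidHomClass.continuous_of_bound (compLinearMap φ hm).toAddMonoidHom C
    fun f => hC f f.2

end FunctionSpace

/-! ### Estimates and membership criteria for the weighted spaces -/

theorem norm_iteratedDeriv_le_weightedNorm {v : Weight} {n : ℕ} {f : ℝ → 𝕜}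
    (hf : f ∈ weightedSubmodule 𝕜 v n) {p : ℕ} (hp : p ≤ n) (x : ℝ) :
    ‖iteratedDeriv p f x‖ ≤ weightedNorm 𝕜 v n ⟨f, hf⟩ * v x := by
  rw [← div_le_iff₀ (v.pos x)]
  refine (le_ciSup (hf.2 p hp) x).trans ?_
  exact le_ciSup (f := fun p : Fin (n + 1) => ⨆ x : ℝ, ‖iteratedDeriv p f x‖ / v x)
    (Set.finite_range _).bddAbove ⟨p, Nat.lt_succ_of_le hp⟩

theorem mem_weightedSubmodule_iff {v : Weight} {n : ℕ} {f : ℝ → 𝕜} :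
    f ∈ weightedSubmodule 𝕜 v n ↔
      ContDiff ℝ n f ∧ ∀ p ≤ n, ∃ C, ∀ x, ‖iteratedDeriv p f x‖ ≤ C * v x := by
  refine and_congr Iff.rfl (forall₂_congr fun p _ => exists_congr fun C => ?_)
  simp only [mem_upperBounds, Set.forall_mem_range, div_le_iff₀ (v.pos _)]

/-- The Faà di Bruno estimate asks for `|φ^(i)| ≤ D ^ i`; since `D ≥ 1`, the plain bound by `D`
suffices. -/
theorem FunctionSpace.CompContinuous.of_weight_bound {φ : ℝ → ℝ} (hφ : ContDiff ℝ ∞ φ)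
    {v w : Weight} {m n : ℕ} (hnm : n ≤ m) {C : ℝ} {D : ℝ → ℝ} (hD1 : ∀ x, 1 ≤ D x)
    (hD : ∀ x, ∀ i, 1 ≤ i → i ≤ n → |iteratedDeriv i φ x| ≤ D x)
    (hC : ∀ x, v (φ x) * D x ^ n ≤ C * w x) :
    CompContinuous φ (spaceBn 𝕜 v m) (spaceBn 𝕜 w n) := by
  have key : ∀ f (hf : f ∈ weightedSubmodule 𝕜 v m), ∀ p ≤ n, ∀ x,
      ‖iteratedDeriv p (f ∘ φ) x‖ ≤ n.factorial * C * weightedNorm 𝕜 v m ⟨f, hf⟩ * w x := by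
    intro f hf p hp x
    have hφm : ContDiff ℝ m φ := hφ.of_le (by exact_mod_cast le_top)
    have hpm : ((p : ℕ) : WithTop ℕ∞) ≤ m := by exact_mod_cast hp.trans hnm
    have hN : 0 ≤ weightedNorm 𝕜 v m ⟨f, hf⟩ := apply_nonneg _ _
    have h := norm_iteratedFDeriv_comp_le hf.1 hφm hpm x
      (C := weightedNorm 𝕜 v m ⟨f, hf⟩ * v (φ x)) (D := D x)
      (fun i hi => by
        rw [norm_iteratedFDeriv_eq_norm_iteratedDeriv]
        exact norm_iteratedDeriv_le_weightedNorm hf (hi.trans (hp.trans hnm)) _)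
      (fun i h1 hi => by
        rw [norm_iteratedFDeriv_eq_norm_iteratedDeriv, Real.norm_eq_abs]
        exact (hD x i h1 (hi.trans hp)).trans (le_self_pow₀ (hD1 x) (by omega)))
    rw [norm_iteratedFDeriv_eq_norm_iteratedDeriv] at h
    have hv := (v.pos (φ x)).le
    have hD0 : 0 ≤ D x := zero_le_one.trans (hD1 x)
    calc _ ≤ _ := h
      _ ≤ n.factorial * (weightedNorm 𝕜 v m ⟨f, hf⟩ * v (φ x)) * D x ^ n := by
        gcongr
        exact hD1 x
      _ = n.factorial * weightedNorm 𝕜 v m ⟨f, hf⟩ * (v (φ x) * D x ^ n) := by ring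
      _ ≤ n.factorial * weightedNorm 𝕜 v m ⟨f, hf⟩ * (C * w x) :=
        mul_le_mul_of_nonneg_left (hC x) (by positivity)
      _ = _ := by ring
  have hmaps : CompMapsTo φ (spaceBn 𝕜 v m) (spaceBn 𝕜 w n) := fun f hf =>
    mem_weightedSubmodule_iff.2
      ⟨(hf.1.of_le (by exact_mod_cast hnm)).comp (hφ.of_le (by exact_mod_cast le_top)),
        fun p hp => ⟨_, key f hf p hp⟩⟩
  refine CompContinuous.of_bound (n.factorial * C) hmaps fun f hf => ?_
  exact ciSup_le fun p => ciSup_le fun x =>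
    (div_le_iff₀ (w.pos x)).2 (key f hf p (Nat.lt_succ_iff.1 p.2) x)

theorem weightedSubmodule_mono {v w : Weight} (h : ∀ x, v x ≤ w x) {m n : ℕ} (hmn : m ≤ n) :
    weightedSubmodule 𝕜 v n ≤ weightedSubmodule 𝕜 w m := fun f hf => by
  rw [mem_weightedSubmodule_iff] at hf ⊢
  refine ⟨hf.1.of_le (by exact_mod_cast hmn), fun p hp => ?_⟩
  obtain ⟨C, hC⟩ := hf.2 p (hp.trans hmn)
  refine ⟨C, fun x => (hC x).trans (mul_le_mul_of_nonneg_left (h x) ?_)⟩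
  exact nonneg_of_mul_nonneg_left ((norm_nonneg _).trans (hC x)) (v.pos x)

theorem mem_spaceB_iff {v : Weight} {f : ℝ → 𝕜} :
    f ∈ (spaceB 𝕜 v).carrier ↔
      ContDiff ℝ ∞ f ∧ ∀ p, ∃ C, ∀ x, ‖iteratedDeriv p f x‖ ≤ C * v x := by
  refine FunctionSpace.mem_projLim.trans ⟨fun h => ?_, fun h n => ?_⟩
  · exact ⟨contDiff_infty.2 fun n => (h n).1,
      fun p => (mem_weightedSubmodule_iff.1 (h p)).2 p le_rfl⟩
  · exact mem_weightedSubmodule_iff.2 ⟨h.1.of_le (by exact_mod_cast le_top), fun p _ => h.2 p⟩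

theorem mem_spaceK_iff {V : WeightSystem} {f : ℝ → 𝕜} :
    f ∈ (spaceK 𝕜 V).carrier ↔
      ContDiff ℝ ∞ f ∧ ∀ N, ∀ p ≤ N, ∃ C, ∀ x, ‖iteratedDeriv p f x‖ ≤ C / V.v N x := by
  refine FunctionSpace.mem_projLim.trans ⟨fun h => ?_, fun h n => ?_⟩
  · refine ⟨contDiff_infty.2 fun n => (h n).1, fun N p hp => ?_⟩
    obtain ⟨C, hC⟩ := (mem_weightedSubmodule_iff.1 (h N)).2 p hp
    exact ⟨C, fun x => (hC x).trans_eq (mul_one_div _ _)⟩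
  · refine mem_weightedSubmodule_iff.2 ⟨h.1.of_le (by exact_mod_cast le_top), fun p hp => ?_⟩
    obtain ⟨C, hC⟩ := h.2 n p hp
    exact ⟨C, fun x => (hC x).trans_eq (mul_one_div _ _).symm⟩

theorem monotone_spaceB_carrier (V : WeightSystem) :
    Monotone fun N => (spaceB 𝕜 (V.v N)).carrier := fun N M h _ hf =>
  FunctionSpace.mem_projLim.2 fun n =>
    weightedSubmodule_mono (V.mono N M h) le_rfl (FunctionSpace.mem_projLim.1 hf n)

theorem monotone_spaceBn_carrier (V : WeightSystem) (n : ℕ) :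
    Monotone fun N => (spaceBn 𝕜 (V.v N) n).carrier := fun N M h =>
  weightedSubmodule_mono (V.mono N M h) le_rfl

theorem mem_spaceOC_iff {V : WeightSystem} {f : ℝ → 𝕜} :
    f ∈ (spaceOC 𝕜 V).carrier ↔ ∃ N, f ∈ (spaceB 𝕜 (V.v N)).carrier :=
  FunctionSpace.mem_indLim (monotone_spaceB_carrier V)

theorem mem_spaceOMn_iff {V : WeightSystem} {n : ℕ} {f : ℝ → 𝕜} :
    f ∈ (spaceOMn 𝕜 V n).carrier ↔ ∃ N, f ∈ weightedSubmodule 𝕜 (V.v N) n :=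
  FunctionSpace.mem_indLim (monotone_spaceBn_carrier V n)

theorem mem_spaceOM_iff {V : WeightSystem} {f : ℝ → 𝕜} :
    f ∈ (spaceOM 𝕜 V).carrier ↔ ∀ n, ∃ N, f ∈ weightedSubmodule 𝕜 (V.v N) n :=
  FunctionSpace.mem_projLim.trans (forall_congr' fun _ => mem_spaceOMn_iff)

theorem spaceOC_le_spaceOM (V : WeightSystem) :
    (spaceOC 𝕜 V).carrier ≤ (spaceOM 𝕜 V).carrier := fun f hf => by
  obtain ⟨N, hN⟩ := mem_spaceOC_iff.1 hf
  exact mem_spaceOM_iff.2 fun n => ⟨N, FunctionSpace.mem_projLim.1 hN n⟩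

end FunctionSpaces

/-! ### A Baire category argument -/

section UniformBoundedness

variable {𝕜 : Type*} [RCLike 𝕜]

/-- A uniform boundedness principle for countable unions of weighted bounds. -/
theorem exists_uniform_weight_bound {X : Type*} [NormedAddCommGroup X] [NormedSpace 𝕜 X]
    [CompleteSpace X] {P Y : Type*} (S : Set P) (T : P → Y → X →L[𝕜] 𝕜) (u : ℕ → Y → ℝ)
    (h : ∀ a, ∃ M, ∀ p ∈ S, ∃ C : ℝ, ∀ x, ‖T p x a‖ ≤ C * u M x) (hu : ∀ M x, 0 < u M x) :
    ∃ M, ∀ p ∈ S, ∃ C : ℝ, ∀ a x, ‖T p x a‖ ≤ C * u M x * ‖a‖ := by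
  let E : ℕ → Set X := fun M => {a | ∀ p ∈ S, ∃ C : ℝ, ∀ x, ‖T p x a‖ ≤ C * u M x}
  -- Baire is used in two stages so that `M` is fixed before `p`: first some `E M` is nonmeagre,
  -- then for each `p` the closed sets `F k` cover it and one of them has interior.
  obtain ⟨M, hM⟩ : ∃ M, ¬ IsMeagre (E M) := by
    by_contra! hE
    refine not_isMeagre_of_isOpen (X := X) isOpen_univ Set.univ_nonempty ?_
    refine (isMeagre_iUnion hE).mono fun a _ => ?_
    exact Set.mem_iUnion.2 (h a)
  refine ⟨M, fun p hp => ?_⟩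
  let F : ℕ → Set X := fun k => {a | ∀ x, ‖T p x a‖ ≤ k * u M x}
  have hF : ∀ k, IsClosed (F k) := fun k => by
    simp only [F, Set.ofPred_forall]
    exact isClosed_iInter fun x => isClosed_le (T p x).continuous.norm continuous_const
  obtain ⟨k, hk⟩ : ∃ k, (interior (F k)).Nonempty := by
    by_contra! hk
    refine hM (IsMeagre.mono ?_ (isMeagre_iUnion fun k =>
      ((hF k).isNowhereDense_iff.2 (hk k)).isMeagre))
    intro a ha
    obtain ⟨C, hC⟩ := ha p hp
    obtain ⟨k, hk⟩ := exists_nat_ge C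
    exact Set.mem_iUnion.2 ⟨k, fun x => (hC x).trans
      (mul_le_mul_of_nonneg_right hk (hu M x).le)⟩
  obtain ⟨a₀, ha₀⟩ := hk
  obtain ⟨r, hr, hball⟩ := Metric.isOpen_iff.1 isOpen_interior a₀ ha₀
  -- A small vector is a difference of two points of `F k`.
  have hsmall : ∀ a : X, ‖a‖ < r → ∀ x, ‖T p x a‖ ≤ 2 * k * u M x := fun a ha x => by
    have h1 := interior_subset (hball (show a₀ + a ∈ Metric.ball a₀ r by simpa using ha)) x
    have h2 := interior_subset ha₀ x
    have h3 : T p x a = T p x (a₀ + a) - T p x a₀ := by simp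
    rw [h3]
    linarith [norm_sub_le (T p x (a₀ + a)) (T p x a₀)]
  refine ⟨2 * k * (2 / r), fun a x => ?_⟩
  rcases eq_or_ne a 0 with rfl | ha
  · simp
  have hna : 0 < ‖a‖ := norm_pos_iff.2 ha
  have hc : ‖((r / (2 * ‖a‖) : ℝ) : 𝕜)‖ = r / (2 * ‖a‖) := by
    rw [RCLike.norm_ofReal, abs_of_pos (by positivity)]
  have h1 := hsmall (((r / (2 * ‖a‖) : ℝ) : 𝕜) • a)
    (by rw [norm_smul, hc]; field_simp; linarith) x
  rw [map_smul, norm_smul, hc, div_mul_eq_mul_div, div_le_iff₀ (by positivity)] at h1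
  have h2 : 2 * k * (2 / r) * u M x * ‖a‖ = (2 * k * u M x * (2 * ‖a‖)) / r := by ring
  rw [h2, le_div_iff₀ hr]
  linarith

end UniformBoundedness

/-! ### Absolutely convergent series of smooth functions -/

section Series

variable {𝕜 : Type*} [RCLike 𝕜] {ι : Type*}

theorem contDiff_tsum_mul {g : ι → ℝ → 𝕜} (hg : ∀ i, ContDiff ℝ ∞ (g i))
    (hb : ∀ p, ∃ C : ℝ, ∀ i y, ‖iteratedDeriv p (g i) y‖ ≤ C)
    {a : ι → 𝕜} (ha : Summable fun i => ‖a i‖) :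
    ContDiff ℝ ∞ fun y => ∑' i, a i * g i y := by
  choose C hC using hb
  refine contDiff_tsum (𝕜 := ℝ) (N := ⊤) (v := fun k i => ‖a i‖ * C k)
    (fun i => contDiff_const.mul (hg i)) (fun k _ => ha.mul_right _) fun k i x _ => ?_
  rw [norm_iteratedFDeriv_eq_norm_iteratedDeriv, iteratedDeriv_const_mul_field, norm_mul]
  exact mul_le_mul_of_nonneg_left (hC k i x) (norm_nonneg _)

theorem iteratedDeriv_tsum_mul {g : ι → ℝ → 𝕜} (hg : ∀ i, ContDiff ℝ ∞ (g i))
    (hb : ∀ p, ∃ C : ℝ, ∀ i y, ‖iteratedDeriv p (g i) y‖ ≤ C)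
    {a : ι → 𝕜} (ha : Summable fun i => ‖a i‖) (p : ℕ) (y : ℝ) :
    iteratedDeriv p (fun y => ∑' i, a i * g i y) y = ∑' i, a i * iteratedDeriv p (g i) y := by
  choose C hC using hb
  have hbound : ∀ k i x, ‖iteratedFDeriv ℝ k (fun y => a i * g i y) x‖ ≤ ‖a i‖ * C k := by
    intro k i x
    rw [norm_iteratedFDeriv_eq_norm_iteratedDeriv, iteratedDeriv_const_mul_field, norm_mul]
    exact mul_le_mul_of_nonneg_left (hC k i x) (norm_nonneg _)
  have h := iteratedFDeriv_tsum_apply (𝕜 := ℝ) (N := ⊤) (v := fun k i => ‖a i‖ * C k)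
    (fun i => contDiff_const.mul (hg i)) (fun k _ => ha.mul_right _)
    (fun k i x _ => hbound k i x) (k := p) le_top y
  have hs : Summable fun i => iteratedFDeriv ℝ p (fun y => a i * g i y) y :=
    Summable.of_norm_bounded (ha.mul_right (C p)) fun i => hbound p i y
  rw [iteratedDeriv_eq_iteratedFDeriv, h, ContinuousMultilinearMap.tsum_eval hs]
  refine tsum_congr fun i => ?_
  rw [← iteratedDeriv_eq_iteratedFDeriv, iteratedDeriv_const_mul_field]

theorem norm_iteratedDeriv_tsum_mul_le {g : ι → ℝ → 𝕜} (hg : ∀ i, ContDiff ℝ ∞ (g i))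
    (hb : ∀ p, ∃ C : ℝ, ∀ i y, ‖iteratedDeriv p (g i) y‖ ≤ C)
    {a : ι → 𝕜} (ha : Summable fun i => ‖a i‖) {p : ℕ} {y C : ℝ}
    (hC : ∀ i, ‖iteratedDeriv p (g i) y‖ ≤ C) :
    ‖iteratedDeriv p (fun y => ∑' i, a i * g i y) y‖ ≤ (∑' i, ‖a i‖) * C := by
  rw [iteratedDeriv_tsum_mul hg hb ha, ← tsum_mul_right]
  refine tsum_of_norm_bounded (ha.mul_right C).hasSum fun i => ?_
  rw [norm_mul]
  exact mul_le_mul_of_nonneg_left (hC i) (norm_nonneg _)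

theorem summable_norm_lp_one (a : lp (fun _ : ι => 𝕜) 1) : Summable fun i => ‖a i‖ := by
  simpa using (lp.memℓp a).summable (by simp)

theorem norm_lp_one_eq_tsum (a : lp (fun _ : ι => 𝕜) 1) : ‖a‖ = ∑' i, ‖a i‖ := by
  simpa using lp.norm_eq_tsum_rpow (by simp) a

/-- A bound on the compositions of all absolutely convergent series over a bounded family of
smooth functions is uniform over the family. -/
theorem exists_uniform_comp_bound {g : ι → ℝ → 𝕜} (hg : ∀ i, ContDiff ℝ ∞ (g i))
    (hb : ∀ p, ∃ C : ℝ, ∀ i y, ‖iteratedDeriv p (g i) y‖ ≤ C)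
    {φ : ℝ → ℝ} (hφ : ContDiff ℝ ∞ φ) (S : Set ℕ) {u : ℕ → ℝ → ℝ} (hu : ∀ M x, 0 < u M x)
    (h : ∀ a : ι → 𝕜, Summable (fun i => ‖a i‖) → ∃ M, ∀ p ∈ S, ∃ C : ℝ, ∀ x,
      ‖iteratedDeriv p ((fun y => ∑' i, a i * g i y) ∘ φ) x‖ ≤ C * u M x) :
    ∃ M, ∀ p ∈ S, ∃ C : ℝ, ∀ i x, ‖iteratedDeriv p (g i ∘ φ) x‖ ≤ C * u M x := by
  classical
  have hb' := hb
  choose C hC using hb'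
  have hcomp : ∀ a : lp (fun _ : ι => 𝕜) 1, ContDiff ℝ ∞ ((fun y => ∑' i, a i * g i y) ∘ φ) :=
    fun a => (contDiff_tsum_mul hg hb (summable_norm_lp_one a)).comp hφ
  have hsum : ∀ (a : lp (fun _ : ι => 𝕜) 1) y, Summable fun i => a i * g i y := fun a y => by
    refine Summable.of_norm_bounded ((summable_norm_lp_one a).mul_right (C 0)) fun i => ?_
    rw [norm_mul]
    exact mul_le_mul_of_nonneg_left (by simpa using hC 0 i y) (norm_nonneg _)
  let L : ℕ → ℝ → lp (fun _ : ι => 𝕜) 1 →ₗ[𝕜] 𝕜 := fun p x =>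
    { toFun := fun a => iteratedDeriv p ((fun y => ∑' i, a i * g i y) ∘ φ) x
      map_add' := fun a b => by
        rw [← iteratedDeriv_add ((hcomp a).of_le (by exact_mod_cast le_top)).contDiffAt
          ((hcomp b).of_le (by exact_mod_cast le_top)).contDiffAt]
        congr 1
        ext y
        simp only [Function.comp_apply, Pi.add_apply, lp.coeFn_add, add_mul]
        exact (hsum a _).tsum_add (hsum b _)
      map_smul' := fun c a => by
        rw [RingHom.id_apply, smul_eq_mul, ← iteratedDeriv_const_mul_field]
        congr 1
        ext y
        simp only [Function.comp_apply, lp.coeFn_smul, Pi.smul_apply, smul_eq_mul, mul_assoc]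
        exact tsum_mul_left }
  -- Here `K` may depend on `p` and `x` in any way: only the continuity of each functional is
  -- needed.
  have hL : ∀ p x, ∃ K : ℝ, ∀ a, ‖L p x a‖ ≤ K * ‖a‖ := by
    intro p x
    let D : ℝ := 1 + ∑ i ∈ Finset.range (p + 1), ‖iteratedDeriv i φ x‖
    let B : ℝ := ∑ i ∈ Finset.range (p + 1), |C i|
    have hD1 : 1 ≤ D := le_add_of_nonneg_right (Finset.sum_nonneg fun _ _ => norm_nonneg _)
    refine ⟨p.factorial * B * D ^ p, fun a => ?_⟩
    have := norm_iteratedFDeriv_comp_le (n := p)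
      (contDiff_tsum_mul hg hb (summable_norm_lp_one a)) hφ
      (by exact_mod_cast le_top) x (C := B * ‖a‖) (D := D)
      (fun i hi => by
        rw [norm_iteratedFDeriv_eq_norm_iteratedDeriv, mul_comm, norm_lp_one_eq_tsum]
        refine norm_iteratedDeriv_tsum_mul_le hg hb (summable_norm_lp_one a) fun j => ?_
        refine (hC i j _).trans ((le_abs_self _).trans ?_)
        exact Finset.single_le_sum (f := fun i => |C i|) (fun _ _ => abs_nonneg _)
          (Finset.mem_range.2 (Nat.lt_succ_of_le hi)))
      (fun i h1 hi => by
        rw [norm_iteratedFDeriv_eq_norm_iteratedDeriv]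
        refine le_trans ?_ (le_self_pow₀ hD1 (by omega))
        have := Finset.single_le_sum (f := fun i => ‖iteratedDeriv i φ x‖)
          (fun _ _ => norm_nonneg _) (Finset.mem_range.2 (Nat.lt_succ_of_le hi))
        linarith)
    rw [norm_iteratedFDeriv_eq_norm_iteratedDeriv] at this
    exact this.trans_eq (by ring)
  choose K hK using hL
  obtain ⟨M, hM⟩ := exists_uniform_weight_bound S
    (fun p x => (L p x).mkContinuous (K p x) (hK p x)) u
    (fun a => h a (summable_norm_lp_one a)) hu
  refine ⟨M, fun p hp => ?_⟩
  obtain ⟨C', hC'⟩ := hM p hp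
  refine ⟨C', fun i x => ?_⟩
  -- The unit vectors of `ℓ¹` recover the individual members of the family.
  have h1 := hC' (lp.single 1 i (1 : 𝕜)) x
  rw [lp.norm_single (by simp), norm_one, mul_one] at h1
  have h2 : (fun y => ∑' j, (lp.single 1 i (1 : 𝕜) : lp (fun _ : ι => 𝕜) 1) j * g j y) = g i := by
    ext y
    rw [tsum_eq_single i fun j hj => by rw [lp.single_apply_ne _ _ _ hj, zero_mul],
      lp.single_apply_self, one_mul]
  change ‖iteratedDeriv p ((fun y => ∑' j,
    (lp.single 1 i (1 : 𝕜) : lp (fun _ : ι => 𝕜) 1) j * g j y) ∘ φ) x‖ ≤ _ at h1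
  rwa [h2] at h1

end Series

/-! ### Landau inequalities for intermediate derivatives -/

section Landau

theorem contDiff_iteratedDeriv {f : ℝ → ℝ} (hf : ContDiff ℝ ∞ f) (p : ℕ) :
    ContDiff ℝ ∞ (iteratedDeriv p f) := by
  induction p with
  | zero => simpa using hf
  | succ p ih =>
    rw [iteratedDeriv_succ]
    exact (contDiff_infty_iff_deriv.1 ih).2

/-- In the induction, `A (p + 2)` is estimated with step `2 * C * h`; this gives `A (p + 1)` the
coefficient `1 / 2` on the right, so it can be absorbed on the left. The larger step is why `δ`
shrinks to `δ / (2 * C)`. -/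
theorem exists_landau_iterate (m : ℕ) : ∃ C δ : ℝ, 1 ≤ C ∧ 0 < δ ∧ δ ≤ 1 / 2 ∧
    ∀ A : ℕ → ℝ, (∀ p h, 0 < h → h ≤ 1 / 2 → A (p + 1) ≤ 2 * A p / h + h * A (p + 2)) →
      (∀ p, 0 ≤ A p) →
      ∀ p h, 0 < h → h ≤ δ → A (p + 1) ≤ C * A p / h + C * h ^ m * A (p + m + 1) := by
  induction m with
  | zero =>
    refine ⟨1, 1 / 2, le_rfl, by norm_num, le_rfl, fun A _ hA p h hh _ => ?_⟩
    have : 0 ≤ A p / h := div_nonneg (hA p) hh.le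
    simpa using this
  | succ m ih =>
    obtain ⟨C, δ, hC, hδ, hδ2, ih⟩ := ih
    have hC0 : 0 < C := by linarith
    refine ⟨4 + 2 * C * (2 * C) ^ m, δ / (2 * C), ?_, by positivity, ?_, ?_⟩
    · have : 0 < 2 * C * (2 * C) ^ m := by positivity
      linarith
    · rw [div_le_iff₀ (by positivity)]
      nlinarith
    intro A hA hA0 p h hh hhδ
    rw [le_div_iff₀ (by positivity)] at hhδ
    have h1 := hA p h hh (by nlinarith)
    have h2 := ih A hA hA0 (p + 1) (h * (2 * C)) (by positivity) hhδ
    have h3 := mul_le_mul_of_nonneg_left h2 hh.le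
    have e1 : h * (C * A (p + 1) / (h * (2 * C)) + C * (h * (2 * C)) ^ m * A (p + 1 + m + 1))
        = A (p + 1) / 2 + C * (2 * C) ^ m * h ^ (m + 1) * A (p + 1 + m + 1) := by
      rw [mul_pow, pow_succ h]
      field_simp
    have e2 : p + 1 + m + 1 = p + (m + 1) + 1 := by omega
    rw [e1, e2] at h3
    have h5 : 0 ≤ A p / h := div_nonneg (hA0 _) hh.le
    have h6 : 0 ≤ h ^ (m + 1) * A (p + (m + 1) + 1) := mul_nonneg (by positivity) (hA0 _)
    have h7 : 0 ≤ 2 * C * (2 * C) ^ m * (A p / h) := by positivity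
    have e3 : A (p + 1 + 1) = A (p + 2) := rfl
    rw [e3] at h3
    have e4 : 2 * A p / h = 2 * (A p / h) := by ring
    have e5 : (4 + 2 * C * (2 * C) ^ m) * A p / h
        = 4 * (A p / h) + 2 * C * (2 * C) ^ m * (A p / h) := by ring
    have e6 : (4 + 2 * C * (2 * C) ^ m) * h ^ (m + 1) * A (p + (m + 1) + 1)
        = 4 * (h ^ (m + 1) * A (p + (m + 1) + 1))
          + 2 * (C * (2 * C) ^ m * h ^ (m + 1) * A (p + (m + 1) + 1)) := by ring
    rw [e5, e6]
    linarith

/-- If the derivatives are `O(W)` and the first one is `O(W ^ ε)` for all `ε`, then so are all the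
others. -/
theorem exists_rpow_bound_of_landau {X : Type*} {A : X → ℕ → ℝ} {W : X → ℝ}
    (hA : ∀ x p h, 0 < h → h ≤ 1 / 2 → A x (p + 1) ≤ 2 * A x p / h + h * A x (p + 2))
    (hA0 : ∀ x p, 0 ≤ A x p) (hW : ∀ x, 1 ≤ W x)
    (hAW : ∀ p, 1 ≤ p → ∃ C : ℝ, ∀ x, A x p ≤ C * W x)
    (hA1 : ∀ k : ℕ, 1 ≤ k → ∃ C : ℝ, ∀ x, A x 1 ≤ C * W x ^ ((1 : ℝ) / k)) (p : ℕ) (hp : 1 ≤ p) :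
    ∀ k : ℕ, 1 ≤ k → ∃ C : ℝ, ∀ x, A x p ≤ C * W x ^ ((1 : ℝ) / k) := by
  induction p, hp using Nat.le_induction with
  | base => exact hA1
  | succ p hp ih =>
    intro k hk
    obtain ⟨C, δ, hC, hδ, hδ2, hL⟩ := exists_landau_iterate (2 * k)
    obtain ⟨K₁, hK₁⟩ := ih (2 * k) (by omega)
    obtain ⟨K₂, hK₂⟩ := hAW (p + 2 * k + 1) (by omega)
    refine ⟨C * |K₁| / δ + C * δ ^ (2 * k) * |K₂|, fun x => ?_⟩
    obtain ⟨r, hr⟩ : ∃ r, r = W x ^ ((1 : ℝ) / (2 * k : ℕ)) := ⟨_, rfl⟩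
    have hW0 : 0 ≤ W x := by linarith [hW x]
    have hk0 : (k : ℝ) ≠ 0 := by positivity
    have hr1 : 1 ≤ r := hr ▸ Real.one_le_rpow (hW x) (by positivity)
    have hr0 : 0 < r := by linarith
    have hrW : r ^ (2 * k) = W x := by
      rw [hr, ← Real.rpow_natCast, ← Real.rpow_mul hW0, one_div_mul_cancel, Real.rpow_one]
      push_cast
      positivity
    have hr2 : W x ^ ((1 : ℝ) / k) = r ^ 2 := by
      rw [hr, ← Real.rpow_natCast, ← Real.rpow_mul hW0]
      congr 1
      push_cast
      field_simp
    -- The step `δ / r` balances the two terms: `A x p / h` is of order `r * r = W ^ (1 / k)`, while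
    -- `h ^ (2 * k) * W` is constant.
    have h1 := hL (A x) (hA x) (hA0 x) p (δ / r) (by positivity) (div_le_self hδ.le hr1)
    have h2 : A x p ≤ |K₁| * r := (hr ▸ hK₁ x).trans (by gcongr; exact le_abs_self _)
    have h3 : A x (p + 2 * k + 1) ≤ |K₂| * r ^ (2 * k) :=
      (hrW.symm ▸ hK₂ x).trans (by gcongr; exact le_abs_self _)
    rw [hr2]
    calc _ ≤ _ := h1
      _ ≤ C * (|K₁| * r) / (δ / r) + C * (δ / r) ^ (2 * k) * (|K₂| * r ^ (2 * k)) := by gcongr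
      _ = C * |K₁| / δ * r ^ 2 + C * δ ^ (2 * k) * |K₂| * 1 := by
        rw [div_pow]
        field_simp
      _ ≤ C * |K₁| / δ * r ^ 2 + C * δ ^ (2 * k) * |K₂| * r ^ 2 := by
        gcongr
        exact one_le_pow₀ hr1
      _ = _ := by ring

/-- By the mean value theorem `|g'| ≤ 2 * A / h` at some point within `h` of `y`, and `g'` varies by
at most `h * B` in between. -/
theorem abs_deriv_le_of_bounds {g : ℝ → ℝ} (hg : ContDiff ℝ ∞ g) {x A B : ℝ}
    (hA : ∀ y ∈ Set.Icc x (x + 1), |g y| ≤ A)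
    (hB : ∀ y ∈ Set.Icc x (x + 1), |deriv (deriv g) y| ≤ B) {h : ℝ} (hh : 0 < h)
    (hh2 : h ≤ 1 / 2) {y : ℝ} (hy : y ∈ Set.Icc x (x + 1)) :
    |deriv g y| ≤ 2 * A / h + h * B := by
  have hd : Differentiable ℝ g := hg.differentiable (by simp)
  have hd' : Differentiable ℝ (deriv g) :=
    (contDiff_infty_iff_deriv.1 hg).2.differentiable (by simp)
  have key : ∀ a b, a ∈ Set.Icc x (x + 1) → b ∈ Set.Icc x (x + 1) → b - a = h →
      (y = a ∨ y = b) → |deriv g y| ≤ 2 * A / h + h * B := by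
    intro a b ha hb hab hya
    obtain ⟨ξ, hξ, hξ'⟩ := exists_deriv_eq_slope g (show a < b by linarith)
      hd.continuous.continuousOn hd.differentiableOn
    have hsub : Set.Icc a b ⊆ Set.Icc x (x + 1) := Set.Icc_subset_Icc ha.1 hb.2
    have hyab : y ∈ Set.Icc a b := by
      rcases hya with rfl | rfl
      exacts [⟨le_rfl, by linarith⟩, ⟨by linarith, le_rfl⟩]
    have h1 : |deriv g ξ| ≤ 2 * A / h := by
      rw [hξ', hab, abs_div, abs_of_pos hh]
      gcongr
      linarith [abs_sub (g b) (g a), hA a ha, hA b hb]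
    have h2 : ‖deriv g y - deriv g ξ‖ ≤ B * ‖y - ξ‖ :=
      (convex_Icc a b).norm_image_sub_le_of_norm_deriv_le (fun z _ => hd' z)
        (fun z hz => hB z (hsub hz)) (Set.Ioo_subset_Icc_self hξ) hyab
    have h3 : ‖y - ξ‖ ≤ h := by
      rw [Real.norm_eq_abs, abs_le]
      constructor <;> linarith [hξ.1, hξ.2, hyab.1, hyab.2]
    have hB0 : 0 ≤ B := (abs_nonneg _).trans (hB y hy)
    rw [Real.norm_eq_abs] at h2
    have h4 := abs_sub_abs_le_abs_sub (deriv g y) (deriv g ξ)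
    nlinarith [mul_le_mul_of_nonneg_left h3 hB0]
  -- Since `h ≤ 1 / 2`, an interval of length `h` on one side of `y` stays in the window.
  rcases le_total y (x + 1 / 2) with hle | hle
  · exact key y (y + h) hy ⟨by linarith [hy.1], by linarith⟩ (by ring) (Or.inl rfl)
  · exact key (y - h) y ⟨by linarith, by linarith [hy.2]⟩ hy (by ring) (Or.inr rfl)

/-- If all derivatives of `φ` are `O(w)` and all powers of the first derivative are `O(w)`, then
all powers of all derivatives are `O(w')`, where `w'` dominates the right translates of `w`. -/
theorem exists_rpow_bound_iteratedDeriv {φ : ℝ → ℝ} (hφ : ContDiff ℝ ∞ φ) {w w' : ℝ → ℝ}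
    (hw' : ∀ x, 1 ≤ w' x) {K : ℝ} (hw0 : ∀ x, 0 ≤ w x)
    (hK : ∀ x t, |t| ≤ 1 → w (x + t) ≤ K * w' x)
    (h : ∀ p, 1 ≤ p → ∃ C : ℝ, ∀ x, |iteratedDeriv p φ x| ≤ C * w x)
    (h1 : ∀ k, 1 ≤ k → ∃ C : ℝ, ∀ x, |deriv φ x| ^ k ≤ C * w x) (p k : ℕ) (hp : 1 ≤ p)
    (hk : 1 ≤ k) : ∃ C : ℝ, ∀ x, |iteratedDeriv p φ x| ≤ C * w' x ^ ((1 : ℝ) / k) := by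
  have hsm : ∀ p, ContDiff ℝ ∞ (iteratedDeriv p φ) := fun p =>
    contDiff_iteratedDeriv hφ p
  -- Suprema over one fixed window for all orders let the Landau inequality be iterated without
  -- losing domain; the price is the passage from `w` to `w'`.
  let A : ℝ → ℕ → ℝ := fun x p => sSup ((fun y => |iteratedDeriv p φ y|) '' Set.Icc x (x + 1))
  have hbdd : ∀ x p, BddAbove ((fun y => |iteratedDeriv p φ y|) '' Set.Icc x (x + 1)) :=
    fun x p => isCompact_Icc.bddAbove_image (hsm p).continuous.abs.continuousOn
  have hle : ∀ x p y, y ∈ Set.Icc x (x + 1) → |iteratedDeriv p φ y| ≤ A x p :=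
    fun x p y hy => le_csSup (hbdd x p) (Set.mem_image_of_mem _ hy)
  have hx : ∀ x : ℝ, x ∈ Set.Icc x (x + 1) := fun x => ⟨le_rfl, by linarith⟩
  have hA_le : ∀ x p B, (∀ y ∈ Set.Icc x (x + 1), |iteratedDeriv p φ y| ≤ B) → A x p ≤ B :=
    fun x p B hB => csSup_le ⟨_, Set.mem_image_of_mem _ (hx x)⟩ (by
      rintro _ ⟨y, hy, rfl⟩
      exact hB y hy)
  have hwK : ∀ x y, y ∈ Set.Icc x (x + 1) → w y ≤ K * w' x := fun x y hy => by
    have := hK x (y - x) (by rw [abs_le]; constructor <;> linarith [hy.1, hy.2])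
    rwa [add_sub_cancel] at this
  have main := exists_rpow_bound_of_landau (A := A) (W := w') ?_
    (fun x p => (abs_nonneg _).trans (hle x p x (hx x))) hw' ?_ ?_ p hp k hk
  · obtain ⟨C, hC⟩ := main
    exact ⟨C, fun x => (hle x p x (hx x)).trans (hC x)⟩
  · intro x p h hh hh2
    refine hA_le _ _ _ fun y hy => ?_
    rw [iteratedDeriv_succ]
    refine abs_deriv_le_of_bounds (hsm p) (hle x p) (fun z hz => ?_) hh hh2 hy
    rw [← iteratedDeriv_succ, ← iteratedDeriv_succ]
    exact hle x _ z hz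
  · intro p hp
    obtain ⟨C, hC⟩ := h p hp
    refine ⟨|C| * K, fun x => hA_le _ _ _ fun y hy => (hC y).trans ?_⟩
    calc C * w y ≤ |C| * w y := mul_le_mul_of_nonneg_right (le_abs_self _) (hw0 y)
      _ ≤ |C| * (K * w' x) := mul_le_mul_of_nonneg_left (hwK x y hy) (abs_nonneg _)
      _ = _ := by ring
  · intro k hk
    obtain ⟨C, hC⟩ := h1 k hk
    refine ⟨(|C| * |K|) ^ ((1 : ℝ) / k), fun x => hA_le _ _ _ fun y hy => ?_⟩
    have hw'0 : 0 ≤ w' x := by linarith [hw' x]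
    rw [iteratedDeriv_one, ← Real.mul_rpow (by positivity) hw'0, one_div]
    rw [Real.le_rpow_inv_iff_of_pos (abs_nonneg _) (by positivity) (by positivity),
      Real.rpow_natCast]
    calc _ ≤ C * w y := hC y
      _ ≤ |C| * w y := mul_le_mul_of_nonneg_right (le_abs_self _) (hw0 y)
      _ ≤ |C| * (K * w' x) := mul_le_mul_of_nonneg_left (hwK x y hy) (abs_nonneg _)
      _ ≤ |C| * (|K| * w' x) := by gcongr; exact le_abs_self K
      _ = _ := by ring

end Landau

/-! ### Products and shifts of weights -/

section WeightSystems

theorem WeightSystem.one_le' (V : WeightSystem) (N : ℕ) (x : ℝ) : 1 ≤ V.v N x :=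
  (V.one_le x).trans (V.mono 0 N N.zero_le x)

theorem Weight.bddAbove_range_div_iff {w : Weight} {f : ℝ → ℝ} :
    BddAbove (Set.range fun x => f x / w x) ↔ ∃ C, ∀ x, f x ≤ C * w x :=
  exists_congr fun C => by
    simp only [mem_upperBounds, Set.forall_mem_range, div_le_iff₀ (w.pos _)]

theorem WeightSystem.exists_shift (V : WeightSystem) (N : ℕ) :
    ∃ M C, N ≤ M ∧ 0 < C ∧ ∀ x t, |t| ≤ 1 → V.v N (x + t) ≤ C * V.v M x := by
  obtain ⟨M, hNM, C, hC⟩ := V.shift N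
  have h : ∀ x t, |t| ≤ 1 → V.v N (x + t) ≤ C * V.v M x := fun x t ht =>
    (div_le_iff₀ ((V.v M).pos x)).1 (hC ⟨x, t, ht, rfl⟩)
  exact ⟨M, C, hNM, pos_of_mul_pos_left (((V.v N).pos _).trans_le (h 0 0 (by simp)))
    ((V.v M).pos 0).le, h⟩

theorem WeightSystem.IsMultiplicative.exists_mul_le {V : WeightSystem} (hV : V.IsMultiplicative)
    (N M : ℕ) : ∃ K C, N ≤ K ∧ M ≤ K ∧ 0 < C ∧ ∀ x, V.v N x * V.v M x ≤ C * V.v K x := by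
  obtain ⟨K, hN, hM, h⟩ := hV N M
  obtain ⟨C, hC⟩ := (V.v K).bddAbove_range_div_iff.1 h
  exact ⟨K, C, hN, hM, pos_of_mul_pos_left
    ((mul_pos ((V.v N).pos 0) ((V.v M).pos 0)).trans_le (hC 0)) ((V.v K).pos 0).le, hC⟩

theorem WeightSystem.IsMultiplicative.exists_pow_le {V : WeightSystem} (hV : V.IsMultiplicative)
    (N n : ℕ) : ∃ K C, 0 < C ∧ ∀ x, V.v N x ^ n ≤ C * V.v K x := by
  induction n with
  | zero => exact ⟨0, 1, one_pos, fun x => by simpa using V.one_le x⟩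
  | succ n ih =>
    obtain ⟨K, C, hC, h⟩ := ih
    obtain ⟨L, C', -, -, hC', h'⟩ := hV.exists_mul_le K N
    refine ⟨L, C * C', by positivity, fun x => ?_⟩
    rw [pow_succ, mul_assoc]
    calc _ ≤ C * V.v K x * V.v N x := mul_le_mul_of_nonneg_right (h x) ((V.v N).pos x).le
      _ = C * (V.v K x * V.v N x) := by ring
      _ ≤ _ := mul_le_mul_of_nonneg_left (h' x) hC.le

end WeightSystems

/-! ### Smooth majorants of weights -/

section Cutoff

/-- A smooth cutoff function, equal to one near the origin and vanishing off `[-1, 1]`. -/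
noncomputable def cutoff : ContDiffBump (0 : ℝ) := ⟨1 / 2, 1, by norm_num, by norm_num⟩

theorem iteratedDeriv_eq_zero_of_notMem_tsupport {f : ℝ → ℝ} {p : ℕ} {y : ℝ}
    (hy : y ∉ tsupport f) : iteratedDeriv p f y = 0 := by
  have h := (notMem_tsupport_iff_eventuallyEq.1 hy).iteratedDeriv_eq p
  rw [h]
  simp

theorem notMem_tsupport_cutoff {y : ℝ} (hy : 1 < |y|) : y ∉ tsupport cutoff := by
  rw [cutoff.tsupport_eq]
  simpa [cutoff] using hy

theorem iteratedDeriv_cutoff_eq_zero (p : ℕ) {y : ℝ} (hy : 1 < |y|) :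
    iteratedDeriv p cutoff y = 0 :=
  iteratedDeriv_eq_zero_of_notMem_tsupport (notMem_tsupport_cutoff hy)

open MeasureTheory Convolution in
/-- Every weight of the system is dominated by a smooth function whose derivatives are
dominated by another weight. -/
theorem WeightSystem.exists_smooth_majorant (V : WeightSystem) (N : ℕ) :
    ∃ (M : ℕ) (f : ℝ → ℝ), ContDiff ℝ ∞ f ∧ (∀ p, ∃ C, ∀ x, |iteratedDeriv p f x| ≤ C * V.v M x) ∧
      ∃ c, ∀ x, V.v N x ≤ c * f x := by
  -- The majorant is the convolution of `v_L` with the cutoff. One shift keeps this average above a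
  -- multiple of `v_N`; the next keeps its derivatives, which fall on the cutoff, below multiples of
  -- `v_M`.
  obtain ⟨L, c, -, hc, hL⟩ := V.exists_shift N
  obtain ⟨M, C, -, hC, hM⟩ := V.exists_shift L
  have hvL := (V.v L).continuous_toFun
  have hloc : LocallyIntegrable (V.v L).toFun volume := hvL.locallyIntegrable
  have hsm : ContDiff ℝ ∞ cutoff := cutoff.contDiff
  have hsmp : ∀ p, ContDiff ℝ ∞ (iteratedDeriv p cutoff) := contDiff_iteratedDeriv hsm
  have hcs : ∀ p, HasCompactSupport (iteratedDeriv p cutoff) := fun p =>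
    HasCompactSupport.intro (isCompact_Icc (a := (-1 : ℝ)) (b := 1)) fun y hy =>
      iteratedDeriv_cutoff_eq_zero p (by
        by_contra! h
        exact hy (abs_le.1 h))
  have hint : ∀ p, Integrable (fun t => iteratedDeriv p cutoff t) :=
    fun p => (hsmp p).continuous.integrable_of_hasCompactSupport (hcs p)
  let F : ℕ → ℝ → ℝ := fun p =>
    iteratedDeriv p cutoff ⋆[ContinuousLinearMap.mul ℝ ℝ, volume] (V.v L).toFun
  have hF : ∀ p x, F p x = ∫ t, iteratedDeriv p cutoff t * V.v L (x - t) := fun p x => rfl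
  have hder : ∀ p, iteratedDeriv p (F 0) = F p := by
    intro p
    induction p with
    | zero => simp
    | succ p ih =>
      rw [iteratedDeriv_succ, ih]
      ext x
      have := ((hcs p).hasDerivAt_convolution_left (ContinuousLinearMap.mul ℝ ℝ)
        ((hsmp p).of_le (by exact_mod_cast le_top)) hloc x).deriv
      rw [← iteratedDeriv_succ] at this
      exact this
  have hIint : ∀ p x, Integrable fun t => iteratedDeriv p cutoff t * V.v L (x - t) := fun p x =>
    ((hsmp p).continuous.mul (hvL.comp (continuous_const.sub continuous_id)))
      |>.integrable_of_hasCompactSupport (hcs p).mul_right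
  have hpos : 0 < ∫ t, cutoff t := cutoff.integral_pos
  refine ⟨M, F 0, (hcs 0).contDiff_convolution_left (n := ⊤)
      (ContinuousLinearMap.mul ℝ ℝ) (hsmp 0) hloc,
    fun p => ⟨(∫ t, |iteratedDeriv p cutoff t|) * C, fun x => ?_⟩, c / ∫ t, cutoff t, fun x => ?_⟩
  · rw [hder, hF, mul_assoc, ← integral_mul_const]
    rw [← Real.norm_eq_abs]
    refine norm_integral_le_of_norm_le ((hint p).abs.mul_const _) (ae_of_all _ fun t => ?_)
    rw [norm_mul, Real.norm_eq_abs, Real.norm_eq_abs, abs_of_pos ((V.v L).pos _)]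
    rcases le_or_gt |t| 1 with ht | ht
    · exact mul_le_mul_of_nonneg_left (hM x (-t) (by rwa [abs_neg])) (abs_nonneg _)
    · simp [iteratedDeriv_cutoff_eq_zero p ht]
  · rw [div_mul_eq_mul_div, le_div_iff₀ hpos, mul_comm, ← integral_mul_const, hF,
      ← integral_const_mul]
    have hi : Integrable fun t => cutoff t * V.v N x := by
      simpa using (hint 0).mul_const (V.v N x)
    refine integral_mono hi ((hIint 0 x).const_mul c) fun t => ?_
    simp only [iteratedDeriv_zero]
    rcases le_or_gt |t| 1 with ht | ht
    · have := hL (x - t) t ht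
      rw [sub_add_cancel] at this
      calc _ ≤ cutoff t * (c * V.v L (x - t)) := mul_le_mul_of_nonneg_left this cutoff.nonneg
        _ = _ := by ring
    · have := iteratedDeriv_cutoff_eq_zero 0 ht
      rw [iteratedDeriv_zero] at this
      simp [this]

end Cutoff

/-! ### Localized powers and their compositions with `φ` -/

section TestFunctions

variable (𝕜 : Type*) [RCLike 𝕜]

theorem iteratedDeriv_ofReal {f : ℝ → ℝ} (hf : ContDiff ℝ ∞ f) (p : ℕ) :
    iteratedDeriv p (fun x => (f x : 𝕜)) = fun x => ((iteratedDeriv p f x : ℝ) : 𝕜) := by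
  induction p with
  | zero => simp
  | succ p ih =>
    rw [iteratedDeriv_succ, ih, iteratedDeriv_succ]
    ext x
    have h := ((contDiff_iteratedDeriv hf p).differentiable (by simp) x).hasDerivAt
    exact ((RCLike.ofRealCLM (K := 𝕜)).hasFDerivAt.comp_hasDerivAt x h).deriv

theorem norm_iteratedDeriv_ofReal {f : ℝ → ℝ} (hf : ContDiff ℝ ∞ f) (p : ℕ) (x : ℝ) :
    ‖iteratedDeriv p (fun x => (f x : 𝕜)) x‖ = |iteratedDeriv p f x| := by
  rw [iteratedDeriv_ofReal 𝕜 hf, RCLike.norm_ofReal]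

theorem contDiff_ofReal {f : ℝ → ℝ} (hf : ContDiff ℝ ∞ f) :
    ContDiff ℝ ∞ fun x => (f x : 𝕜) :=
  (RCLike.ofRealCLM (K := 𝕜)).contDiff.comp hf

/-- The `k`-th power of the distance to `y₀`, cut off away from `y₀`. -/
noncomputable def localPow (k : ℕ) (y₀ y : ℝ) : 𝕜 :=
  ((cutoff (y - y₀) * (y - y₀) ^ k : ℝ) : 𝕜)

theorem contDiff_localPow_real (k : ℕ) : ContDiff ℝ ∞ fun y : ℝ => cutoff y * y ^ k :=
  cutoff.contDiff.mul (contDiff_id.pow k)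

theorem contDiff_localPow (k : ℕ) (y₀ : ℝ) : ContDiff ℝ ∞ (localPow 𝕜 k y₀) :=
  contDiff_ofReal 𝕜 ((contDiff_localPow_real k).comp (contDiff_id.sub contDiff_const))

theorem norm_iteratedDeriv_localPow (k p : ℕ) (y₀ y : ℝ) :
    ‖iteratedDeriv p (localPow 𝕜 k y₀) y‖
      = |iteratedDeriv p (fun y : ℝ => cutoff y * y ^ k) (y - y₀)| := by
  have h := norm_iteratedDeriv_ofReal 𝕜 ((contDiff_localPow_real k).comp
    (contDiff_id.sub (contDiff_const (c := y₀)))) p y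
  have h2 := iteratedDeriv_comp_sub_const p (fun y : ℝ => cutoff y * y ^ k) y₀
  refine h.trans ?_
  rw [← congrFun h2 y]
  rfl

theorem tsupport_cutoff_mul_pow (k : ℕ) :
    tsupport (fun y : ℝ => cutoff y * y ^ k) ⊆ tsupport cutoff :=
  tsupport_mul_subset_left

theorem iteratedDeriv_localPow_eq_zero (k p : ℕ) {y₀ y : ℝ} (hy : 1 < |y - y₀|) :
    ‖iteratedDeriv p (localPow 𝕜 k y₀) y‖ = 0 := by
  rw [norm_iteratedDeriv_localPow, iteratedDeriv_eq_zero_of_notMem_tsupport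
    fun h => notMem_tsupport_cutoff hy (tsupport_cutoff_mul_pow k h), abs_zero]

theorem exists_norm_iteratedDeriv_localPow_le (k p : ℕ) :
    ∃ C : ℝ, 0 < C ∧ ∀ y₀ y, ‖iteratedDeriv p (localPow 𝕜 k y₀) y‖ ≤ C := by
  have hc : Continuous (iteratedDeriv p fun y : ℝ => cutoff y * y ^ k) :=
    (contDiff_iteratedDeriv (contDiff_localPow_real k) p).continuous
  have hs : HasCompactSupport (iteratedDeriv p fun y : ℝ => cutoff y * y ^ k) :=
    HasCompactSupport.intro (isCompact_Icc (a := (-1 : ℝ)) (b := 1)) fun y hy =>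
      iteratedDeriv_eq_zero_of_notMem_tsupport fun h =>
        notMem_tsupport_cutoff (by
          by_contra! h
          exact hy (abs_le.1 h)) (tsupport_cutoff_mul_pow k h)
  obtain ⟨C, hC⟩ := hs.exists_bound_of_continuous hc
  refine ⟨|C| + 1, by positivity, fun y₀ y => ?_⟩
  rw [norm_iteratedDeriv_localPow]
  linarith [hC (y - y₀), le_abs_self C, Real.norm_eq_abs
    (iteratedDeriv p (fun y : ℝ => cutoff y * y ^ k) (y - y₀))]

/-- The cutoff equals one near the origin, so it is invisible in the germ at `x`. -/
theorem norm_iteratedDeriv_localPow_comp {φ : ℝ → ℝ} (hφ : ContDiff ℝ ∞ φ) (k p : ℕ) (x : ℝ) :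
    ‖iteratedDeriv p (localPow 𝕜 k (φ x) ∘ φ) x‖
      = |iteratedDeriv p (fun t => (φ t - φ x) ^ k) x| := by
  rw [← norm_iteratedDeriv_ofReal 𝕜 ((hφ.sub contDiff_const).pow k)]
  congr 1
  refine Filter.EventuallyEq.iteratedDeriv_eq p ?_
  have h1 : Filter.Tendsto (fun t => φ t - φ x) (nhds x) (nhds 0) := by
    have : Continuous fun t => φ t - φ x := hφ.continuous.sub continuous_const
    simpa using this.tendsto x
  filter_upwards [h1.eventually cutoff.eventuallyEq_one] with t ht
  simp only [Function.comp_apply, localPow, ht, Pi.one_apply, one_mul]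

/-- The smooth factor `r` makes the induction close: one differentiation lowers the power of `f` by
one and puts the rest into a new factor, equal to `(k + 1) * f' * r` where `f` vanishes. -/
theorem iteratedDeriv_pow_mul_eq {f r : ℝ → ℝ} (hf : ContDiff ℝ ∞ f) (hr : ContDiff ℝ ∞ r) {x : ℝ}
    (hx : f x = 0) (k : ℕ) :
    iteratedDeriv k (fun t => f t ^ k * r t) x = k.factorial * deriv f x ^ k * r x := by
  induction k generalizing r with
  | zero => simp
  | succ k ih =>
    have hf' := (contDiff_infty_iff_deriv.1 hf).2
    have hr' := (contDiff_infty_iff_deriv.1 hr).2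
    have hd : deriv (fun t => f t ^ (k + 1) * r t)
        = fun t => f t ^ k * ((k + 1) * deriv f t * r t + f t * deriv r t) := by
      ext t
      have h1 := (hf.differentiable (by simp) t).hasDerivAt
      have h2 := (hr.differentiable (by simp) t).hasDerivAt
      rw [((h1.fun_pow (k + 1)).fun_mul h2).deriv]
      push_cast
      ring
    rw [iteratedDeriv_succ', hd,
      ih (((contDiff_const.mul hf').mul hr).add (hf.mul hr')), hx, Nat.factorial_succ]
    push_cast
    ring

theorem norm_iteratedDeriv_localPow_comp_self {φ : ℝ → ℝ} (hφ : ContDiff ℝ ∞ φ) (k : ℕ) (x : ℝ) :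
    ‖iteratedDeriv k (localPow 𝕜 k (φ x) ∘ φ) x‖ = k.factorial * |deriv φ x| ^ k := by
  rw [norm_iteratedDeriv_localPow_comp 𝕜 hφ]
  have h := iteratedDeriv_pow_mul_eq (hφ.sub (contDiff_const (c := φ x)))
    (contDiff_const (c := (1 : ℝ))) (sub_self (φ x)) k
  simp only [mul_one, deriv_sub_const] at h
  rw [h, abs_mul, abs_pow, Nat.abs_cast]

theorem norm_iteratedDeriv_localPow_one_comp {φ : ℝ → ℝ} (hφ : ContDiff ℝ ∞ φ) {p : ℕ}
    (hp : 1 ≤ p) (x : ℝ) :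
    ‖iteratedDeriv p (localPow 𝕜 1 (φ x) ∘ φ) x‖ = |iteratedDeriv p φ x| := by
  rw [norm_iteratedDeriv_localPow_comp 𝕜 hφ]
  obtain ⟨p, rfl⟩ := Nat.exists_eq_add_of_le' hp
  simp only [pow_one, iteratedDeriv_succ', deriv_sub_const_fun]

theorem norm_localPow_zero_comp (φ : ℝ → ℝ) (x : ℝ) :
    ‖iteratedDeriv 0 (localPow 𝕜 0 (φ x) ∘ φ) x‖ = 1 := by
  have : cutoff 0 = 1 := cutoff.eventuallyEq_one.eq_of_nhds
  simp [localPow, this]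

end TestFunctions

/-! ### Merging families of constants -/

section Bounds

theorem exists_common_bound {X : Type*} {F : ℕ → X → ℝ} {U : X → ℝ} (hU : ∀ x, 0 ≤ U x)
    (h : ∀ p, 1 ≤ p → ∃ C : ℝ, ∀ x, F p x ≤ C * U x) (n : ℕ) :
    ∃ C : ℝ, 1 ≤ C ∧ ∀ p, 1 ≤ p → p ≤ n → ∀ x, F p x ≤ C * U x := by
  choose! C hC using h
  refine ⟨1 + ∑ i ∈ Finset.range (n + 1), |C i|,
    le_add_of_nonneg_right (Finset.sum_nonneg fun _ _ => abs_nonneg _), fun p hp hpn x => ?_⟩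
  refine (hC p hp x).trans (mul_le_mul_of_nonneg_right ?_ (hU x))
  have := Finset.single_le_sum (f := fun i => |C i|) (fun _ _ => abs_nonneg _)
    (Finset.mem_range.2 (Nat.lt_succ_of_le hpn))
  linarith [le_abs_self (C p)]

theorem WeightSystem.exists_common_bound (V : WeightSystem) {ψ : ℝ → ℝ} {F : ℕ → ℝ → ℝ}
    (h : ∀ p, 1 ≤ p → ∃ (N : ℕ) (C : ℝ), ∀ x, F p x ≤ C * V.v N (ψ x)) (n : ℕ) :
    ∃ (L : ℕ) (C : ℝ), 1 ≤ C ∧ ∀ p, 1 ≤ p → p ≤ n → ∀ x, F p x ≤ C * V.v L (ψ x) := by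
  choose! N C hC using h
  let L := (Finset.range (n + 1)).sup N
  obtain ⟨K, hK1, hK⟩ := _root_.exists_common_bound (X := ℝ)
    (F := fun p x => if p ≤ n then F p x else 0) (U := fun x => V.v L (ψ x))
    (fun x => ((V.v L).pos _).le) (fun p hp => ⟨|C p|, fun x => by
      have h0 := ((V.v L).pos (ψ x)).le
      by_cases hpn : p ≤ n
      · simp only [hpn, if_true]
        calc _ ≤ C p * V.v (N p) (ψ x) := hC p hp x
          _ ≤ |C p| * V.v (N p) (ψ x) :=
            mul_le_mul_of_nonneg_right (le_abs_self _) ((V.v _).pos _).le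
          _ ≤ |C p| * V.v L (ψ x) := mul_le_mul_of_nonneg_left (V.mono _ _
            (Finset.le_sup (Finset.mem_range.2 (Nat.lt_succ_of_le hpn))) _) (abs_nonneg _)
      · simp only [hpn, if_false]
        positivity⟩) n
  refine ⟨L, K, hK1, fun p hp hpn x => ?_⟩
  simpa [hpn] using hK p hp hpn x

/-- Dividing by the sum over `p ≤ k` bounds the product by `1` once `k ≥ p`, leaving finitely many
`k`. This lets test functions of all powers form one bounded family. -/
theorem exists_scaling (B : ℕ → ℕ → ℝ) (hB : ∀ k p, 0 < B k p) :
    ∃ c : ℕ → ℝ, (∀ k, 0 < c k) ∧ ∀ p, ∃ C : ℝ, ∀ k, c k * B k p ≤ C := by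
  have hpos : ∀ k, 1 ≤ 1 + ∑ p ∈ Finset.range (k + 1), B k p := fun k =>
    le_add_of_nonneg_right (Finset.sum_nonneg fun _ _ => (hB _ _).le)
  refine ⟨fun k => 1 / (1 + ∑ p ∈ Finset.range (k + 1), B k p),
    fun k => one_div_pos.2 (one_pos.trans_le (hpos k)),
    fun p => ⟨1 + ∑ k ∈ Finset.range p, B k p, fun k => ?_⟩⟩
  rw [one_div_mul_eq_div, div_le_iff₀ (one_pos.trans_le (hpos k))]
  have h1 : 0 ≤ ∑ k ∈ Finset.range p, B k p := Finset.sum_nonneg fun _ _ => (hB _ _).le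
  rcases lt_or_ge k p with hk | hk
  · have := Finset.single_le_sum (f := fun k => B k p) (fun _ _ => (hB _ _).le)
      (Finset.mem_range.2 hk)
    nlinarith [hpos k, hB k p]
  · have := Finset.single_le_sum (f := fun p => B k p) (fun _ _ => (hB _ _).le)
      (Finset.mem_range.2 (Nat.lt_succ_of_le hk))
    nlinarith [hpos k, hB k p]

end Bounds

/-! ### From inclusions to growth conditions -/

section Necessity

variable {𝕜 : Type*} [RCLike 𝕜]

open FunctionSpace

theorem tsum_mul_mem_spaceOC {ι : Type*} (V : WeightSystem) {g : ι → ℝ → 𝕜}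
    (hg : ∀ i, ContDiff ℝ ∞ (g i))
    (hb : ∀ p, ∃ C : ℝ, ∀ i y, ‖iteratedDeriv p (g i) y‖ ≤ C) {a : ι → 𝕜}
    (ha : Summable fun i => ‖a i‖) : (fun y => ∑' i, a i * g i y) ∈ (spaceOC 𝕜 V).carrier := by
  refine mem_spaceOC_iff.2 ⟨0, mem_spaceB_iff.2 ⟨contDiff_tsum_mul hg hb ha, fun p => ?_⟩⟩
  obtain ⟨C, hC⟩ := hb p
  refine ⟨(∑' i, ‖a i‖) * |C|, fun x => ?_⟩
  refine (norm_iteratedDeriv_tsum_mul_le hg hb ha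
    fun i => (hC i x).trans (le_abs_self C)).trans ?_
  exact le_mul_of_one_le_right
    (mul_nonneg (tsum_nonneg fun _ => norm_nonneg _) (abs_nonneg _)) (V.one_le x)

/-- Mapping the smaller space `𝓞_C` into the larger `𝓞_M` follows from the inclusions in both (II)
and (III), so one argument serves both. -/
theorem exists_weight_comp_le {V W : WeightSystem} {φ : ℝ → ℝ}
    (h : ∀ f ∈ (spaceOC 𝕜 V).carrier, f ∘ φ ∈ (spaceOM 𝕜 W).carrier) (N : ℕ) :
    ∃ (M : ℕ) (C : ℝ), ∀ x, V.v N (φ x) ≤ C * W.v M x := by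
  obtain ⟨M, f, hf, hfM, c, hc⟩ := V.exists_smooth_majorant N
  have hmem : (fun x => (f x : 𝕜)) ∈ (spaceOC 𝕜 V).carrier := by
    refine mem_spaceOC_iff.2 ⟨M, mem_spaceB_iff.2 ⟨contDiff_ofReal 𝕜 hf, fun p => ?_⟩⟩
    simpa only [norm_iteratedDeriv_ofReal 𝕜 hf] using hfM p
  obtain ⟨L, hL⟩ := mem_spaceOM_iff.1 (h _ hmem) 0
  obtain ⟨C, hC⟩ := (mem_weightedSubmodule_iff.1 hL).2 0 le_rfl
  simp only [iteratedDeriv_zero, Function.comp_apply, RCLike.norm_ofReal] at hC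
  refine ⟨L, |c| * C, fun x => ?_⟩
  calc _ ≤ c * f (φ x) := hc _
    _ ≤ |c| * |f (φ x)| := (le_abs_self _).trans_eq (abs_mul _ _)
    _ ≤ |c| * (C * W.v L x) := mul_le_mul_of_nonneg_left (hC x) (abs_nonneg _)
    _ = _ := by ring

theorem exists_iteratedDeriv_le_of_comp_mem_spaceOM {V W : WeightSystem} {φ : ℝ → ℝ}
    (hφ : ContDiff ℝ ∞ φ)
    (h : ∀ f ∈ (spaceOC 𝕜 V).carrier, f ∘ φ ∈ (spaceOM 𝕜 W).carrier) (p : ℕ) (hp : 1 ≤ p) :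
    ∃ (M : ℕ) (C : ℝ), ∀ x, |iteratedDeriv p φ x| ≤ C * W.v M x := by
  have hg : ∀ x, ContDiff ℝ ∞ (localPow 𝕜 1 (φ x)) := fun x => contDiff_localPow 𝕜 1 (φ x)
  have hb : ∀ p, ∃ C : ℝ, ∀ x y, ‖iteratedDeriv p (localPow 𝕜 1 (φ x)) y‖ ≤ C := fun p => by
    obtain ⟨C, -, hC⟩ := exists_norm_iteratedDeriv_localPow_le 𝕜 1 p
    exact ⟨C, fun x => hC (φ x)⟩
  obtain ⟨M, hM⟩ := exists_uniform_comp_bound hg hb hφ {p} (u := fun M => W.v M)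
    (fun M => (W.v M).pos) fun a ha => by
      obtain ⟨M, hM⟩ := mem_spaceOM_iff.1 (h _ (tsum_mul_mem_spaceOC V hg hb ha)) p
      refine ⟨M, fun q hq => ?_⟩
      obtain rfl := Set.mem_singleton_iff.1 hq
      exact (mem_weightedSubmodule_iff.1 hM).2 q le_rfl
  obtain ⟨C, hC⟩ := hM p rfl
  exact ⟨M, C, fun x => norm_iteratedDeriv_localPow_one_comp 𝕜 hφ hp x ▸ hC x x⟩

theorem exists_rpow_bound_of_compMapsTo_spaceOC {V W : WeightSystem} {φ : ℝ → ℝ}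
    (hφ : ContDiff ℝ ∞ φ) (h : CompMapsTo φ (spaceOC 𝕜 V) (spaceOC 𝕜 W)) :
    ∃ M : ℕ, ∀ p k : ℕ, 1 ≤ p → 1 ≤ k → ∃ C : ℝ, ∀ x,
      |iteratedDeriv p φ x| ≤ C * W.v M x ^ ((1 : ℝ) / k) := by
  choose B hB0 hB using exists_norm_iteratedDeriv_localPow_le 𝕜
  obtain ⟨c, hc0, hc⟩ := exists_scaling B hB0
  -- Centres and exponents are indexed together, so that a single `M` serves all powers at once.
  let g : ℝ × ℕ → ℝ → 𝕜 := fun i y => (c i.2 : 𝕜) * localPow 𝕜 i.2 (φ i.1) y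
  have hg : ∀ i, ContDiff ℝ ∞ (g i) := fun i => contDiff_const.mul (contDiff_localPow 𝕜 _ _)
  have hnorm : ∀ k, ‖(c k : 𝕜)‖ = c k := fun k => by rw [RCLike.norm_ofReal, abs_of_pos (hc0 k)]
  have hb : ∀ p, ∃ C : ℝ, ∀ i y, ‖iteratedDeriv p (g i) y‖ ≤ C := fun p => by
    obtain ⟨C, hC⟩ := hc p
    refine ⟨C, fun i y => ?_⟩
    simp only [g, iteratedDeriv_const_mul_field, norm_mul, hnorm]
    exact (mul_le_mul_of_nonneg_left (hB _ _ _ _) (hc0 _).le).trans (hC i.2)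
  obtain ⟨M, hM⟩ := exists_uniform_comp_bound hg hb hφ Set.univ (u := fun M => W.v M)
    (fun M => (W.v M).pos) fun a ha => by
      obtain ⟨M, hM⟩ := mem_spaceOC_iff.1 (h _ (tsum_mul_mem_spaceOC V hg hb ha))
      exact ⟨M, fun p _ => (mem_spaceB_iff.1 hM).2 p⟩
  have key : ∀ k p, ∃ C : ℝ, ∀ x,
      ‖iteratedDeriv p (localPow 𝕜 k (φ x) ∘ φ) x‖ ≤ C * W.v M x := fun k p => by
    obtain ⟨C, hC⟩ := hM p trivial
    refine ⟨C / c k, fun x => ?_⟩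
    have h1 := hC (x, k) x
    have h2 : g (x, k) ∘ φ = fun t => (c k : 𝕜) * (localPow 𝕜 k (φ x) ∘ φ) t := rfl
    rw [h2, iteratedDeriv_const_mul_field, norm_mul, hnorm] at h1
    rw [div_mul_eq_mul_div, le_div_iff₀ (hc0 k)]
    linarith
  obtain ⟨M', K, -, -, hK⟩ := W.exists_shift M
  refine ⟨M', fun p k hp hk => exists_rpow_bound_iteratedDeriv hφ (w := W.v M) (w' := W.v M')
    (W.one_le' M') (fun x => ((W.v M).pos x).le) hK ?_ ?_ p k hp hk⟩
  · intro p hp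
    obtain ⟨C, hC⟩ := key 1 p
    exact ⟨C, fun x => norm_iteratedDeriv_localPow_one_comp 𝕜 hφ hp x ▸ hC x⟩
  · intro k _
    obtain ⟨C, hC⟩ := key k k
    refine ⟨C, fun x => ?_⟩
    have h1 := hC x
    rw [norm_iteratedDeriv_localPow_comp_self 𝕜 hφ] at h1
    refine le_trans ?_ h1
    exact le_mul_of_one_le_left (by positivity) (by exact_mod_cast k.factorial_pos)

/-- If the bound fails, take a violating point `x j` for each index and constant `j`. The bumps
divided by `v_j (φ (x j))` form a bounded family in `𝓚_V`, so the compositions obey a common bound,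
which fails at `x j` once `j` exceeds it. The centres need not be separated, because the
coefficients are in `ℓ¹`. -/
theorem exists_localPow_comp_bound_of_compMapsTo_spaceK {V W : WeightSystem} {φ : ℝ → ℝ}
    (hφ : ContDiff ℝ ∞ φ) (h : CompMapsTo φ (spaceK 𝕜 V) (spaceK 𝕜 W)) (k : ℕ) {p M : ℕ}
    (hpM : p ≤ M) :
    ∃ (N : ℕ) (C : ℝ), ∀ x,
      W.v M x * ‖iteratedDeriv p (localPow 𝕜 k (φ x) ∘ φ) x‖ ≤ C * V.v N (φ x) := by
  by_contra! hcon
  choose x hx using fun N : ℕ => hcon N N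
  choose B hB0 hB using exists_norm_iteratedDeriv_localPow_le 𝕜 k
  let r : ℕ → ℝ := fun j => 1 / V.v j (φ (x j))
  have hr0 : ∀ j, 0 < r j := fun j => one_div_pos.2 ((V.v j).pos _)
  let g : ℕ → ℝ → 𝕜 := fun j y => (r j : 𝕜) * localPow 𝕜 k (φ (x j)) y
  have hg : ∀ i, ContDiff ℝ ∞ (g i) := fun i => contDiff_const.mul (contDiff_localPow 𝕜 _ _)
  have hnorm : ∀ j, ‖(r j : 𝕜)‖ = r j := fun j => by rw [RCLike.norm_ofReal, abs_of_pos (hr0 j)]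
  have hgn : ∀ q j y, ‖iteratedDeriv q (g j) y‖
      = r j * ‖iteratedDeriv q (localPow 𝕜 k (φ (x j))) y‖ := fun q j y => by
    simp only [g, iteratedDeriv_const_mul_field, norm_mul, hnorm]
  have hbV : ∀ N q, ∃ C : ℝ, ∀ j y, ‖iteratedDeriv q (g j) y‖ ≤ C / V.v N y := by
    intro N q
    obtain ⟨N', K, -, hK, hN'⟩ := V.exists_shift N
    let S : ℝ := 1 + ∑ j ∈ Finset.range N', V.v N' (φ (x j))
    -- Monotonicity gives `v_N' ≤ v_j` only for `j ≥ N'`; the sum takes care of the finitely many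
    -- earlier centres.
    have hS0 : 0 ≤ ∑ j ∈ Finset.range N', V.v N' (φ (x j)) :=
      Finset.sum_nonneg fun _ _ => ((V.v _).pos _).le
    have hS : ∀ j, V.v N' (φ (x j)) ≤ S * V.v j (φ (x j)) := fun j => by
      have h1 := V.one_le' j (φ (x j))
      rcases lt_or_ge j N' with hj | hj
      · have h2 := Finset.single_le_sum (f := fun j => V.v N' (φ (x j)))
          (fun _ _ => ((V.v _).pos _).le) (Finset.mem_range.2 hj)
        have h3 : (V.v N') (φ (x j)) ≤ S := by simp only [S]; linarith
        exact h3.trans (le_mul_of_one_le_right (by positivity) h1)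
      · exact (V.mono N' j hj _).trans
          (le_mul_of_one_le_left (by linarith) (le_add_of_nonneg_right hS0))
    refine ⟨B q * (K * S), fun j y => ?_⟩
    rw [hgn, le_div_iff₀ ((V.v N).pos y)]
    have hBK : 0 ≤ B q * (K * S) := mul_nonneg (hB0 q).le (mul_nonneg hK.le (by positivity))
    rcases le_or_gt |y - φ (x j)| 1 with hy | hy
    · have h1 := hN' (φ (x j)) (y - φ (x j)) hy
      rw [add_sub_cancel] at h1
      have h2 : V.v N y ≤ K * (S * V.v j (φ (x j))) :=
        h1.trans (mul_le_mul_of_nonneg_left (hS j) hK.le)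
      have h3 : r j * V.v j (φ (x j)) = 1 := one_div_mul_cancel ((V.v j).pos _).ne'
      have h0 := (hr0 j).le
      have hB0' := (hB0 q).le
      have hv0 := ((V.v N).pos y).le
      calc _ ≤ r j * B q * V.v N y :=
            mul_le_mul_of_nonneg_right (mul_le_mul_of_nonneg_left (hB q _ _) h0) hv0
        _ ≤ r j * B q * (K * (S * V.v j (φ (x j)))) :=
            mul_le_mul_of_nonneg_left h2 (mul_nonneg h0 hB0')
        _ = B q * (K * S) * (r j * V.v j (φ (x j))) := by ring
        _ = _ := by rw [h3, mul_one]
    · rw [iteratedDeriv_localPow_eq_zero 𝕜 k q hy]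
      simpa using hBK
  have hb : ∀ q, ∃ C : ℝ, ∀ j y, ‖iteratedDeriv q (g j) y‖ ≤ C := fun q => by
    refine ⟨B q, fun j y => ?_⟩
    rw [hgn]
    refine (mul_le_of_le_one_left (norm_nonneg _) ?_).trans (hB q _ y)
    exact (div_le_one₀ ((V.v j).pos _)).2 (V.one_le' j _)
  have hmem : ∀ a : ℕ → 𝕜, Summable (fun i => ‖a i‖) →
      (fun y => ∑' i, a i * g i y) ∈ (spaceK 𝕜 V).carrier := fun a ha => by
    refine mem_spaceK_iff.2 ⟨contDiff_tsum_mul hg hb ha, fun N q _ => ?_⟩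
    obtain ⟨C, hC⟩ := hbV N q
    refine ⟨(∑' i, ‖a i‖) * C, fun y => ?_⟩
    rw [mul_div_assoc]
    exact norm_iteratedDeriv_tsum_mul_le hg hb ha fun i => hC i y
  -- The target weight is fixed, so the sequence of weights is constant and the index found is
  -- irrelevant.
  obtain ⟨-, hM⟩ := exists_uniform_comp_bound hg hb hφ {p} (u := fun _ => (W.v M).inv)
    (fun _ => (W.v M).inv.pos) fun a ha => ⟨0, fun q hq => by
      obtain rfl := Set.mem_singleton_iff.1 hq
      exact (mem_weightedSubmodule_iff.1 (mem_projLim.1 (h _ (hmem a ha)) M)).2 q hpM⟩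
  obtain ⟨C, hC⟩ := hM p rfl
  obtain ⟨j, hj⟩ := exists_nat_ge C
  have h1 := hC j (x j)
  have h2 : g j ∘ φ = fun t => (r j : 𝕜) * (localPow 𝕜 k (φ (x j)) ∘ φ) t := rfl
  rw [h2, iteratedDeriv_const_mul_field, norm_mul, hnorm] at h1
  have h3 : (W.v M).inv (x j) = 1 / W.v M (x j) := rfl
  rw [h3, mul_one_div, one_div_mul_eq_div, div_le_div_iff₀ ((V.v j).pos _) ((W.v M).pos _)] at h1
  have h4 := mul_le_mul_of_nonneg_right hj ((V.v j).pos (φ (x j))).le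
  linarith [hx j]

end Necessity

/-! ### From growth conditions to continuity -/

section Sufficiency

variable {𝕜 : Type*} [RCLike 𝕜]

open FunctionSpace

theorem compContinuous_spaceK {V W : WeightSystem} (hV : V.IsMultiplicative) {φ : ℝ → ℝ}
    (hφ : ContDiff ℝ ∞ φ)
    (ha : ∀ M : ℕ, ∃ (N : ℕ) (C : ℝ), ∀ x, W.v M x ≤ C * V.v N (φ x))
    (hb : ∀ p : ℕ, 1 ≤ p → ∃ (N : ℕ) (C : ℝ), ∀ x, |iteratedDeriv p φ x| ≤ C * V.v N (φ x)) :
    CompContinuous φ (spaceK 𝕜 V) (spaceK 𝕜 W) := by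
  refine CompContinuous.projLim fun M => ?_
  obtain ⟨N, C₁, h₁⟩ := ha M
  obtain ⟨L, C₂, hC₂, h₂⟩ := V.exists_common_bound (F := fun p x => |iteratedDeriv p φ x|) hb M
  obtain ⟨L', C₃, hC₃, h₃⟩ := hV.exists_pow_le L M
  obtain ⟨K, C₄, -, -, hC₄, h₄⟩ := hV.exists_mul_le N L'
  -- In `𝓚_V` one index governs both weight and smoothness, so it must also be at least `M`.
  refine ⟨max K M, CompContinuous.of_weight_bound hφ (le_max_right K M)
    (C := |C₁| * (C₂ ^ M * C₃) * C₄) (D := fun x => C₂ * V.v L (φ x))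
    (fun x => one_le_mul_of_one_le_of_one_le hC₂ (V.one_le' L _)) (fun x i h1 hi => h₂ i h1 hi x)
    fun x => ?_⟩
  change 1 / V.v (max K M) (φ x) * _ ≤ _ * (1 / W.v M x)
  rw [one_div_mul_eq_div, mul_one_div, div_le_div_iff₀ ((V.v _).pos _) ((W.v M).pos x)]
  have p1 := (V.v N).pos (φ x)
  have p2 := (V.v L).pos (φ x)
  have p3 := (V.v L').pos (φ x)
  calc (C₂ * V.v L (φ x)) ^ M * W.v M x
      ≤ (C₂ * V.v L (φ x)) ^ M * (|C₁| * V.v N (φ x)) := by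
        refine mul_le_mul_of_nonneg_left ((h₁ x).trans ?_) (by positivity)
        exact mul_le_mul_of_nonneg_right (le_abs_self _) p1.le
    _ = C₂ ^ M * (|C₁| * V.v N (φ x)) * V.v L (φ x) ^ M := by ring
    _ ≤ C₂ ^ M * (|C₁| * V.v N (φ x)) * (C₃ * V.v L' (φ x)) :=
        mul_le_mul_of_nonneg_left (h₃ _) (by positivity)
    _ = |C₁| * (C₂ ^ M * C₃) * (V.v N (φ x) * V.v L' (φ x)) := by ring
    _ ≤ |C₁| * (C₂ ^ M * C₃) * (C₄ * V.v K (φ x)) :=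
        mul_le_mul_of_nonneg_left (h₄ _) (by positivity)
    _ ≤ |C₁| * (C₂ ^ M * C₃) * (C₄ * V.v (max K M) (φ x)) := by
        gcongr
        exact V.mono _ _ (le_max_left _ _) _
    _ = _ := by ring

theorem compContinuous_spaceB {V W : WeightSystem} (hW : W.IsMultiplicative) {φ : ℝ → ℝ}
    (hφ : ContDiff ℝ ∞ φ)
    (ha : ∀ N : ℕ, ∃ (M : ℕ) (C : ℝ), ∀ x, V.v N (φ x) ≤ C * W.v M x)
    (hb : ∃ M : ℕ, ∀ p k : ℕ, 1 ≤ p → 1 ≤ k → ∃ C : ℝ, ∀ x,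
      |iteratedDeriv p φ x| ≤ C * W.v M x ^ ((1 : ℝ) / k)) (N : ℕ) :
    ∃ M, CompContinuous φ (spaceB 𝕜 (V.v N)) (spaceB 𝕜 (W.v M)) := by
  obtain ⟨M₁, C₁, h₁⟩ := ha N
  obtain ⟨M₂, hM₂⟩ := hb
  obtain ⟨K, C₄, -, -, hC₄, h₄⟩ := hW.exists_mul_le M₁ M₂
  refine ⟨K, CompContinuous.projLim fun n => ⟨n, ?_⟩⟩
  -- The exponent `1 / (n + 1)` makes `D ^ n ≤ D ^ (n + 1)` a multiple of `v_{M₂}` for every `n`, so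
  -- `K` is independent of `n`; using `n + 1` also covers `n = 0`.
  obtain ⟨C₂, hC₂, h₂⟩ := exists_common_bound (F := fun p x => |iteratedDeriv p φ x|)
    (U := fun x => W.v M₂ x ^ ((1 : ℝ) / (n + 1 : ℕ)))
    (fun x => Real.rpow_nonneg ((W.v _).pos _).le _) (fun p hp => hM₂ p (n + 1) hp (by omega)) n
  have hD1 : ∀ x, 1 ≤ C₂ * W.v M₂ x ^ ((1 : ℝ) / (n + 1 : ℕ)) := fun x =>
    one_le_mul_of_one_le_of_one_le hC₂ (Real.one_le_rpow (W.one_le' M₂ _) (by positivity))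
  refine CompContinuous.of_weight_bound hφ le_rfl (C := |C₁| * C₂ ^ (n + 1) * C₄)
    (D := fun x => C₂ * W.v M₂ x ^ ((1 : ℝ) / (n + 1 : ℕ))) hD1
    (fun x i h1 hi => h₂ i h1 hi x) fun x => ?_
  have p1 := (W.v M₁).pos x
  have p2 := (W.v M₂).pos x
  have hpow : (W.v M₂ x ^ ((1 : ℝ) / (n + 1 : ℕ))) ^ (n + 1) = W.v M₂ x := by
    rw [one_div, Real.rpow_inv_natCast_pow p2.le (by omega)]
  calc _ ≤ (|C₁| * W.v M₁ x) * (C₂ * W.v M₂ x ^ ((1 : ℝ) / (n + 1 : ℕ))) ^ (n + 1) := by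
        refine mul_le_mul ((h₁ x).trans ?_) (pow_le_pow_right₀ (hD1 x) (by omega))
          (by positivity) (by positivity)
        exact mul_le_mul_of_nonneg_right (le_abs_self _) p1.le
    _ = |C₁| * C₂ ^ (n + 1) * (W.v M₁ x * W.v M₂ x) := by rw [mul_pow, hpow]; ring
    _ ≤ |C₁| * C₂ ^ (n + 1) * (C₄ * W.v K x) :=
        mul_le_mul_of_nonneg_left (h₄ _) (by positivity)
    _ = _ := by ring

theorem compContinuous_spaceOMn {V W : WeightSystem} (hW : W.IsMultiplicative) {φ : ℝ → ℝ}
    (hφ : ContDiff ℝ ∞ φ)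
    (ha : ∀ N : ℕ, ∃ (M : ℕ) (C : ℝ), ∀ x, V.v N (φ x) ≤ C * W.v M x)
    (hb : ∀ p : ℕ, 1 ≤ p → ∃ (M : ℕ) (C : ℝ), ∀ x, |iteratedDeriv p φ x| ≤ C * W.v M x) (n : ℕ) :
    CompContinuous φ (spaceOMn 𝕜 V n) (spaceOMn 𝕜 W n) := by
  refine CompContinuous.indLim (monotone_spaceBn_carrier V n) (monotone_spaceBn_carrier W n)
    fun N => ?_
  obtain ⟨M₁, C₁, h₁⟩ := ha N
  obtain ⟨L, C₂, hC₂, h₂⟩ := W.exists_common_bound (ψ := id)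
    (F := fun p x => |iteratedDeriv p φ x|) hb n
  obtain ⟨L', C₃, hC₃, h₃⟩ := hW.exists_pow_le L n
  obtain ⟨K, C₄, -, -, hC₄, h₄⟩ := hW.exists_mul_le M₁ L'
  refine ⟨K, CompContinuous.of_weight_bound hφ le_rfl
    (C := |C₁| * (C₂ ^ n * C₃) * C₄) (D := fun x => C₂ * W.v L x)
    (fun x => one_le_mul_of_one_le_of_one_le hC₂ (W.one_le' L _)) (fun x i h1 hi => h₂ i h1 hi x)
    fun x => ?_⟩
  have p1 := (W.v M₁).pos x
  have p2 := (W.v L).pos x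
  calc _ ≤ (|C₁| * W.v M₁ x) * (C₂ * W.v L x) ^ n := by
        refine mul_le_mul_of_nonneg_right ((h₁ x).trans ?_) (by positivity)
        exact mul_le_mul_of_nonneg_right (le_abs_self _) p1.le
    _ = C₂ ^ n * (|C₁| * W.v M₁ x) * W.v L x ^ n := by ring
    _ ≤ C₂ ^ n * (|C₁| * W.v M₁ x) * (C₃ * W.v L' x) :=
        mul_le_mul_of_nonneg_left (h₃ _) (by positivity)
    _ = |C₁| * (C₂ ^ n * C₃) * (W.v M₁ x * W.v L' x) := by ring
    _ ≤ |C₁| * (C₂ ^ n * C₃) * (C₄ * W.v K x) :=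
        mul_le_mul_of_nonneg_left (h₄ _) (by positivity)
    _ = _ := by ring

end Sufficiency

/-! ### The three equivalences -/

theorem theorem2 (𝕜 : Type*) [RCLike 𝕜] (V W : WeightSystem) (φ : ℝ → ℝ)
    (hφ : ContDiff ℝ ∞ φ) :
    (V.IsMultiplicative →
      List.TFAE [
        FunctionSpace.CompMapsTo φ (spaceK 𝕜 V) (spaceK 𝕜 W),
        FunctionSpace.CompContinuous φ (spaceK 𝕜 V) (spaceK 𝕜 W),
        (∀ M : ℕ, ∃ N : ℕ, BddAbove (Set.range fun x : ℝ => W.v M x / V.v N (φ x))) ∧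
          (∀ p : ℕ, 1 ≤ p → ∃ N : ℕ,
            BddAbove (Set.range fun x : ℝ => |iteratedDeriv p φ x| / V.v N (φ x)))]) ∧
    (W.IsMultiplicative →
      List.TFAE [
        FunctionSpace.CompMapsTo φ (spaceOC 𝕜 V) (spaceOC 𝕜 W),
        FunctionSpace.CompContinuous φ (spaceOC 𝕜 V) (spaceOC 𝕜 W),
        ∀ N : ℕ, ∃ M : ℕ, FunctionSpace.CompContinuous φ (spaceB 𝕜 (V.v N)) (spaceB 𝕜 (W.v M)),
        (∀ N : ℕ, ∃ M : ℕ, BddAbove (Set.range fun x : ℝ => V.v N (φ x) / W.v M x)) ∧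
          (∃ M : ℕ, ∀ p k : ℕ, 1 ≤ p → 1 ≤ k →
            BddAbove (Set.range fun x : ℝ =>
              |iteratedDeriv p φ x| / (W.v M x) ^ ((1 : ℝ) / (k : ℝ))))]) ∧
    (W.IsMultiplicative →
      List.TFAE [
        FunctionSpace.CompMapsTo φ (spaceOM 𝕜 V) (spaceOM 𝕜 W),
        FunctionSpace.CompContinuous φ (spaceOM 𝕜 V) (spaceOM 𝕜 W),
        ∀ n : ℕ, FunctionSpace.CompContinuous φ (spaceOMn 𝕜 V n) (spaceOMn 𝕜 W n),
        (∀ N : ℕ, ∃ M : ℕ, BddAbove (Set.range fun x : ℝ => V.v N (φ x) / W.v M x)) ∧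
          (∀ p : ℕ, 1 ≤ p → ∃ M : ℕ,
            BddAbove (Set.range fun x : ℝ => |iteratedDeriv p φ x| / W.v M x))]) := by
  have hbdd : ∀ (f g : ℝ → ℝ), (∀ x, 0 < g x) →
      (BddAbove (Set.range fun x => f x / g x) ↔ ∃ C, ∀ x, f x ≤ C * g x) := fun f g hg =>
    exists_congr fun C => by
      simp only [mem_upperBounds, Set.forall_mem_range, div_le_iff₀ (hg _)]
  have hV : ∀ (f : ℝ → ℝ) N, BddAbove (Set.range fun x => f x / V.v N (φ x)) ↔
      ∃ C, ∀ x, f x ≤ C * V.v N (φ x) := fun f N => hbdd f _ fun x => (V.v N).pos _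
  have hW : ∀ (f : ℝ → ℝ) M, BddAbove (Set.range fun x => f x / W.v M x) ↔
      ∃ C, ∀ x, f x ≤ C * W.v M x := fun f M => hbdd f _ (W.v M).pos
  have hWr : ∀ (f : ℝ → ℝ) M (k : ℕ),
      BddAbove (Set.range fun x => f x / W.v M x ^ ((1 : ℝ) / k)) ↔
      ∃ C, ∀ x, f x ≤ C * W.v M x ^ ((1 : ℝ) / k) := fun f M k =>
    hbdd f _ fun x => Real.rpow_pos_of_pos ((W.v M).pos x) _
  simp only [hV, hW, hWr]
  refine ⟨fun hmul => ?_, fun hmul => ?_, fun hmul => ?_⟩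
  · tfae_have 2 → 1 := fun h => h.1
    tfae_have 3 → 2 := fun h => compContinuous_spaceK hmul hφ h.1 h.2
    tfae_have 1 → 3 := fun h => by
      refine ⟨fun M => ?_, fun p hp => ?_⟩
      · simpa only [norm_localPow_zero_comp 𝕜, mul_one] using
          exists_localPow_comp_bound_of_compMapsTo_spaceK hφ h 0 (Nat.zero_le M)
      -- Order `p` is controlled in `𝓚_W` from index `p` on; the surplus weight is at least one and
      -- is dropped.
      · obtain ⟨N, C, hC⟩ := exists_localPow_comp_bound_of_compMapsTo_spaceK hφ h 1 (le_refl p)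
        refine ⟨N, C, fun x => ?_⟩
        have h1 := hC x
        rw [norm_iteratedDeriv_localPow_one_comp 𝕜 hφ hp] at h1
        exact (le_mul_of_one_le_left (abs_nonneg _) (W.one_le' p x)).trans h1
    tfae_finish
  · tfae_have 2 → 1 := fun h => h.1
    tfae_have 3 → 2 := FunctionSpace.CompContinuous.indLim
      (monotone_spaceB_carrier V) (monotone_spaceB_carrier W)
    tfae_have 4 → 3 := fun h => compContinuous_spaceB hmul hφ h.1 h.2
    tfae_have 1 → 4 := fun h =>
      ⟨exists_weight_comp_le fun f hf => spaceOC_le_spaceOM W (h f hf),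
        exists_rpow_bound_of_compMapsTo_spaceOC hφ h⟩
    tfae_finish
  · tfae_have 2 → 1 := fun h => h.1
    tfae_have 3 → 2 := fun h => FunctionSpace.CompContinuous.projLim fun n => ⟨n, h n⟩
    tfae_have 4 → 3 := fun h => compContinuous_spaceOMn hmul hφ h.1 h.2
    tfae_have 1 → 4 := fun h =>
      have h' : ∀ f ∈ (spaceOC 𝕜 V).carrier, f ∘ φ ∈ (spaceOM 𝕜 W).carrier :=
        fun f hf => h f (spaceOC_le_spaceOM V hf)
      ⟨exists_weight_comp_le h', exists_iteratedDeriv_le_of_comp_mem_spaceOM hφ h'⟩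
    tfae_finish
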